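/- Let $s,t\ge 6$ be integers such that $t$ is even or $s=t$, and put $S=s-4$, $T=t-4$. Conventions. A loop in a simplicial complex $X$ is a subcomplex isomorphic to a triangulation of the circle. A filling diagram $(D,f)$ for a loop $\gamma$ is a simplicial map $f\colon D\to X$ from a triangulated $2$-disc $D$ that restricts to an isomorphism $\partial D\to\gamma$; it is minimal if $D$ has the least possible number of triangles among all filling diagrams for $\gamma$. A $k$-vertex of $D$ is an interior vertex of $D$ with exactly $k$ neighbours. Let $A,B$ be sets of vertices of $D$. The pair $(A,B)$ is called alternating if the interior vertices of $D$ are the disjoint union of $A$ and $B$, $A$ consists of $s$-vertices, $B$ consists of $t$-vertices, every neighbour of a vertex of $A$ is in $B$ or on the boundary, and the neighbours of every vertex of $B$ form a full cycle $(v_1,\dots,v_t)$ in $D$ in which the $v_i$ with $i$ odd are in $B$ or on the boundary and the $v_i$ with $i$ even are in $A$ or on the boundary. A flag, simply connected simplicial complex $X$ is $(s,t)$-uniform if for every loop $\gamma$ in $X$ and every minimal filling diagram $(D,f)$ for $\gamma$ the following holds: if $s=t$, every interior vertex of $D$ is a $t$-vertex; if $s\ne t$, the pair (set of $s$-vertices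 of $D$, set of $t$-vertices of $D$) is alternating. Let $X$ be an $(s,t)$-uniform simplicial complex, $\gamma$ a loop in $X$, $(D,f)$ a minimal filling diagram for $\gamma$, and $v$ an interior vertex of $D$. For $n\ge 0$ let the sphere $S_n$ be the set of edges of $D$ both of whose endpoints are at distance $n$ from $v$ in the $1$-skeleton of $D$. Let $(A,B)$ be the pair (set of $s$-vertices of $D$, set of $t$-vertices of $D$) or, if $s=t$ is even, any alternating pair. Let $V_n$ and $W_n$ be the sets of vertices in $A$, respectively in $B$, that are endpoints of edges of $S_n$. Let $E_n$ be the set of edges of $S_n$ spanned by a vertex of $A$ and a vertex of $B$, and $F_n$ the set of edges of $S_n$ spanned by two vertices of $B$. Let $n\ge 4$ and consider the recurrence $$x_n=\frac T2\,x_{n-1}+\Bigl(\frac{ST}2-2\Bigr)x_{n-2}+\frac T2\,x_{n-3}-x_{n-4}.\qquad(*)$$ 1. If all vertices of $D$ at distance less than $n$ from $v$ are interior, then the sphere lengths $x_k=|S_k|$ satisfy $(*)$. 2. If all vertices of $D$ at distance at most $n$ from $v$ are interior, then each of the sequences $x_k=|V_k|$, $x_k=|W_k|$, $x_k=|E_k|$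 and $x_k=|F_k|$ satisfies $(*)$. -/

import Mathlib

universe u v

noncomputable section

namespace STUniform

open Classical in
/-- The 1-skeleton of a simplicial complex, as a graph. -/
def skeleton {V : Type u} (K : AbstractSimplicialComplex V) : SimpleGraph V where
  Adj x y := x ≠ y ∧ ({x, y} : Finset V) ∈ K.faces
  symm := ⟨fun x y h => ⟨h.1.symm, by rw [Finset.pair_comm]; exact h.2⟩⟩
  loopless := ⟨fun _ h => h.1 rfl⟩

/-- A complex is flag if every nonempty finite set of pairwise adjacent vertices is a simplex. -/
def IsFlag {V : Type u} (K : AbstractSimplicialComplex V) : Prop :=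
  ∀ σ : Finset V, σ.Nonempty → (σ : Set V).Pairwise (skeleton K).Adj → σ ∈ K.faces

open Classical in
/-- Homotopy (with fixed ends) of edge paths: generated by deleting a backtracking and by
replacing two sides of a triangle of `K` by the third one. -/
inductive EdgeHomotopic {V : Type u} (K : AbstractSimplicialComplex V) :
    ∀ {x y : V}, (skeleton K).Walk x y → (skeleton K).Walk x y → Prop
  | refl {x y : V} (p : (skeleton K).Walk x y) : EdgeHomotopic K p p
  | symm {x y : V} {p q : (skeleton K).Walk x y} :
      EdgeHomotopic K p q → EdgeHomotopic K q p
  | trans {x y : V} {p q r : (skeleton K).Walk x y} :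
      EdgeHomotopic K p q → EdgeHomotopic K q r → EdgeHomotopic K p r
  | append {x y z : V} {p p' : (skeleton K).Walk x y} {q q' : (skeleton K).Walk y z} :
      EdgeHomotopic K p p' → EdgeHomotopic K q q' →
        EdgeHomotopic K (p.append q) (p'.append q')
  | backtrack {x y : V} (h : (skeleton K).Adj x y) :
      EdgeHomotopic K (.cons h (.cons h.symm .nil)) .nil
  | triangle {x y z : V} (hxy : (skeleton K).Adj x y) (hyz : (skeleton K).Adj y z)
      (hxz : (skeleton K).Adj x z) (hf : ({x, y, z} : Finset V) ∈ K.faces) :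
      EdgeHomotopic K (.cons hxy (.cons hyz .nil)) (.cons hxz .nil)

/-- Simple connectedness: connected, with trivial edge-path group. -/
def IsSimplyConnected {V : Type u} (K : AbstractSimplicialComplex V) : Prop :=
  (skeleton K).Connected ∧
    ∀ (x : V) (p : (skeleton K).Walk x x), EdgeHomotopic K p .nil

/-- A loop (cycle) in `K`: a subcomplex isomorphic to a triangulation of the circle, that is,
a finite connected 2-regular subgraph of the 1-skeleton. -/
def IsLoop {V : Type u} {K : AbstractSimplicialComplex V} (γ : (skeleton K).Subgraph) : Prop :=
  γ.verts.Finite ∧ γ.Connected ∧ ∀ x ∈ γ.verts, (γ.neighborSet x).ncard = 2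

/-- The set of 2-simplices. -/
def triangles {V : Type u} (K : AbstractSimplicialComplex V) : Set (Finset V) :=
  {σ | σ ∈ K.faces ∧ σ.card = 3}

open Classical in
/-- The vertices which together with `x` and `y` span a 2-simplex. -/
def apexes {V : Type u} (K : AbstractSimplicialComplex V) (x y : V) : Set V :=
  {z | z ≠ x ∧ z ≠ y ∧ ({x, y, z} : Finset V) ∈ K.faces}

/-- The link of the vertex `x` in a complex of dimension at most 2, as a graph on the
neighbours of `x`. -/
def linkGraph {V : Type u} (K : AbstractSimplicialComplex V) (x : V) :
    SimpleGraph ((skeleton K).neighborSet x) :=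
  SimpleGraph.fromRel fun y z => (z : V) ∈ apexes K x y

open Classical in
theorem apexes_comm {V : Type u} (K : AbstractSimplicialComplex V) (x y : V) :
    apexes K x y = apexes K y x := by
  ext z
  simp only [apexes, Set.mem_ofPred_eq, Finset.insert_comm x y {z}]
  tauto

/-- The graph of boundary edges: the edges which lie in exactly one 2-simplex. -/
def boundary {V : Type u} (D : AbstractSimplicialComplex V) : SimpleGraph V where
  Adj x y := (skeleton D).Adj x y ∧ (apexes D x y).ncard = 1
  symm := ⟨fun x y h => ⟨h.1.symm, by rw [apexes_comm]; exact h.2⟩⟩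
  loopless := ⟨fun x h => (skeleton D).irrefl h.1⟩

/-- A vertex is a boundary vertex if it lies on a boundary edge, and interior otherwise. -/
def IsBoundary {V : Type u} (D : AbstractSimplicialComplex V) (x : V) : Prop :=
  ∃ y, (boundary D).Adj x y

def IsInterior {V : Type u} (D : AbstractSimplicialComplex V) (x : V) : Prop :=
  ¬ IsBoundary D x

/-- Triangulated 2-discs: finite connected triangulated surfaces (each vertex link is a cycle or
a path with at least one edge, i.e. a finite connected graph with all degrees 1 or 2), with
nonempty boundary and with Euler characteristic 1.  By the classification of compact surfaces
these are precisely the simplicial complexes homeomorphic to the closed 2-disc. -/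
structure IsDisc {V : Type u} (D : AbstractSimplicialComplex V) : Prop where
  finite : Finite V
  connected : (skeleton D).Connected
  card_le : ∀ σ ∈ D.faces, σ.card ≤ 3
  link_connected : ∀ x, (linkGraph D x).Connected
  link_degree : ∀ x y, (skeleton D).Adj x y →
    (apexes D x y).ncard = 1 ∨ (apexes D x y).ncard = 2
  boundary_nonempty : ∃ x, IsBoundary D x
  euler : (Nat.card V : ℤ) - (skeleton D).edgeSet.ncard + (triangles D).ncard = 1

open Classical in
/-- `(D, f)` is a filling diagram for `γ`: `D` is a triangulated disc and `f` is a simplicial map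
which restricts to an isomorphism of the boundary cycle onto `γ`. -/
structure IsFilling {U : Type u} {X : AbstractSimplicialComplex U} (γ : (skeleton X).Subgraph)
    {V : Type v} (D : AbstractSimplicialComplex V) (f : V → U) : Prop where
  disc : IsDisc D
  simplicial : ∀ σ ∈ D.faces, σ.image f ∈ X.faces
  injOn : Set.InjOn f {x | IsBoundary D x}
  image_eq : f '' {x | IsBoundary D x} = γ.verts
  adj_iff : ∀ x y, IsBoundary D x → IsBoundary D y →
    ((boundary D).Adj x y ↔ γ.Adj (f x) (f y))

/-- A filling diagram with the least number of 2-simplices. -/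
def IsMinimalFilling {U : Type u} {X : AbstractSimplicialComplex U}
    (γ : (skeleton X).Subgraph) {V : Type v} (D : AbstractSimplicialComplex V)
    (f : V → U) : Prop :=
  IsFilling γ D f ∧
    ∀ (V' : Type v) (D' : AbstractSimplicialComplex V') (f' : V' → U),
      IsFilling γ D' f' → (triangles D).ncard ≤ (triangles D').ncard

/-- The set of `k`-vertices of `D`: the interior vertices with exactly `k` neighbours. -/
def kVertices {V : Type u} (D : AbstractSimplicialComplex V) (k : ℕ) : Set V :=
  {x | IsInterior D x ∧ ((skeleton D).neighborSet x).ncard = k}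

/-- The interior vertices of `D` are split into a set `A` of vertices with `s` neighbours and
a set `B` of vertices with `t` neighbours in such a way that neighbours of a vertex of `A` are in
`B` or on the boundary, and the neighbours of a vertex of `B` form a full cycle whose members are
alternately in `B` (or on the boundary) and in `A` (or on the boundary).
The cycle is indexed from `0`, so the odd positions `1, 3, …` of the cycle
`(v_1, …, v_t)` are the even indices here. -/
structure IsAlternating {V : Type u} (D : AbstractSimplicialComplex V) (s t : ℕ)
    (A B : Set V) : Prop where
  union : A ∪ B = {x | IsInterior D x}
  disjoint : Disjoint A B
  left : A ⊆ kVertices D s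
  right : B ⊆ kVertices D t
  nbrs_left : ∀ x ∈ A, ∀ y, (skeleton D).Adj x y → y ∈ B ∨ IsBoundary D y
  nbrs_right : ∀ x ∈ B, ∃ c : Fin t → V, Function.Injective c ∧
    Set.range c = (skeleton D).neighborSet x ∧
    (∀ i j : Fin t, (skeleton D).Adj (c i) (c j) ↔
      (i.val + 1) % t = j.val ∨ (j.val + 1) % t = i.val) ∧
    (∀ i : Fin t, Even i.val → c i ∈ B ∨ IsBoundary D (c i)) ∧
    (∀ i : Fin t, Odd i.val → c i ∈ A ∨ IsBoundary D (c i))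

/-- `(s,t)`-uniform complexes.  (For `s = t` this is `t`-uniformity.) -/
structure IsUniform {U : Type u} (X : AbstractSimplicialComplex U) (s t : ℕ) : Prop where
  four_le_left : 4 ≤ s
  four_le_right : 4 ≤ t
  flag : IsFlag X
  simplyConnected : IsSimplyConnected X
  of_eq : s = t → ∀ γ : (skeleton X).Subgraph, IsLoop γ →
    ∀ (V : Type v) (D : AbstractSimplicialComplex V) (f : V → U),
      IsMinimalFilling γ D f → ∀ x, IsInterior D x → x ∈ kVertices D t
  of_ne : s ≠ t → ∀ γ : (skeleton X).Subgraph, IsLoop γ →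
    ∀ (V : Type v) (D : AbstractSimplicialComplex V) (f : V → U),
      IsMinimalFilling γ D f → IsAlternating D s t (kVertices D s) (kVertices D t)

/-- The sphere of radius `n` about `o`: the edges spanned by the vertices at distance `n`. -/
def sphere {V : Type u} (D : AbstractSimplicialComplex V) (o : V) (n : ℕ) : Set (Sym2 V) :=
  {e | e ∈ (skeleton D).edgeSet ∧ ∀ x ∈ e, (skeleton D).dist o x = n}

/-- The vertices of `A` on the sphere; only vertices on edges of the sphere are considered, so
there are none for radius `0`. -/
def sphereVerts {V : Type u} (D : AbstractSimplicialComplex V) (A : Set V) (o : V) (n : ℕ) :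
    Set V :=
  {x | x ∈ A ∧ ∃ e ∈ sphere D o n, x ∈ e}

/-- The edges of the sphere spanned by a vertex of `A` and a vertex of `B`. -/
def sphereEdges {V : Type u} (D : AbstractSimplicialComplex V) (A B : Set V) (o : V) (n : ℕ) :
    Set (Sym2 V) :=
  {e | e ∈ sphere D o n ∧ ∃ a ∈ A, ∃ b ∈ B, e = s(a, b)}

/-- The recurrence
`x_n = T/2 x_{n-1} + (ST/2 - 2) x_{n-2} + T/2 x_{n-3} - x_{n-4}` at the index `n`, where
`S = s - 4` and `T = t - 4`; used for `n ≥ 4` only. -/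
def RecAt (s t : ℕ) (x : ℕ → ℕ) (n : ℕ) : Prop :=
  (x n : ℚ) = ((t : ℚ) - 4) / 2 * x (n - 1) +
    (((s : ℚ) - 4) * ((t : ℚ) - 4) / 2 - 2) * x (n - 2) +
    ((t : ℚ) - 4) / 2 * x (n - 3) - x (n - 4)

end STUniform

end

/-!
In a triangulated disc every mod-2 cycle of edges bounds a unique set of triangles, so each circuit
cuts off a region with Euler characteristic one, and Gauss–Bonnet holds on it. As the interior
degrees are at least six, applying this to a minimal geodesic bigon shows that the neighbours of a
vertex `x` nearer to the centre form a clique of at most two vertices, and that the ends of an edge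
of a sphere have a common nearer neighbour. Hence every vertex of a sphere has exactly two
neighbours on that sphere. Double counting the edges and triangles between consecutive spheres then
gives, for `v_k = |V_k|` and `w_k = |W_k|`,
`|S_{k+2}| + |S_k| + 4 |S_{k+1}| = s v_{k+1} + t w_{k+1}` and
`2 v_{k+2} + 2 v_k + 4 w_{k+1} = t w_{k+1}`,
and since `|S_k| = v_k + w_k`, all the recurrences are linear combinations of these two.
-/

noncomputable section

namespace STUniform

open Finset Module

section LinearAlgebra

variable {K L M N : Type*} [Field K] [AddCommGroup L] [Module K L] [AddCommGroup M] [Module K M]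
  [AddCommGroup N] [Module K N]

theorem finrank_map_add_finrank_inf_ker [FiniteDimensional K M] (d : M →ₗ[K] N)
    (C : Submodule K M) : finrank K (C.map d) + finrank K ↥(C ⊓ LinearMap.ker d) = finrank K C := by
  rw [← LinearMap.finrank_range_add_finrank_ker (d.domRestrict C), LinearMap.range_domRestrict,
    LinearMap.ker_domRestrict, ← Submodule.finrank_map_subtype_eq,
    Submodule.map_comap_subtype]

variable [FiniteDimensional K L] [FiniteDimensional K M]

theorem map_eq_inf_ker_of_finrank {d₂ : L →ₗ[K] M} {d₁ : M →ₗ[K] N} {C₂ : Submodule K L}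
    {C₁ : Submodule K M} (hmap : C₂.map d₂ ≤ C₁ ⊓ LinearMap.ker d₁)
    (hinj : C₂ ⊓ LinearMap.ker d₂ = ⊥) (hrank : finrank K N ≤ finrank K (C₁.map d₁) + 1)
    (heuler : finrank K C₁ + 1 ≤ finrank K N + finrank K C₂) :
    C₂.map d₂ = C₁ ⊓ LinearMap.ker d₁ := by
  have h₁ := finrank_map_add_finrank_inf_ker d₁ C₁
  have h₂ := finrank_map_add_finrank_inf_ker d₂ C₂
  rw [hinj, finrank_bot] at h₂
  exact Submodule.eq_of_le_of_finrank_le hmap (by omega)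

theorem finrank_add_one_le_of_inf_ker_le [FiniteDimensional K N] {d₂ : L →ₗ[K] M}
    {d₁ : M →ₗ[K] N} {C₂ : Submodule K L} {C₁ : Submodule K M} {C₀ : Submodule K N}
    (hlt : C₁.map d₁ < C₀)
    (hexact : C₁ ⊓ LinearMap.ker d₁ ≤ C₂.map d₂) :
    finrank K C₁ + 1 ≤ finrank K C₀ + finrank K C₂ := by
  have h₁ := finrank_map_add_finrank_inf_ker d₁ C₁
  have h₂ := Submodule.finrank_lt_finrank_of_lt hlt
  have h₃ := Submodule.finrank_mono hexact
  have h₄ := Submodule.finrank_map_le d₂ C₂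
  omega

/-- The functions `ι → K` which vanish outside `E`: the chains of a complex with set `E` of
cells, inside the chains of the full simplex. -/
def supportedOn (K : Type*) [Field K] {ι : Type*} (E : Set ι) : Submodule K (ι → K) :=
  ⨅ i ∈ Eᶜ, LinearMap.ker (LinearMap.proj i)

theorem mem_supportedOn {ι : Type*} {E : Set ι} {z : ι → K} :
    z ∈ supportedOn K E ↔ ∀ i ∉ E, z i = 0 := by
  simp [supportedOn]

theorem finrank_supportedOn {ι : Type*} [Finite ι] (E : Set ι) :
    finrank K (supportedOn K E) = E.ncard := by
  classical
  have := Fintype.ofFinite ι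
  rw [supportedOn, (LinearMap.iInfKerProjEquiv K (fun _ => K) disjoint_compl_right
    (Set.union_compl_self E).ge).finrank_eq, finrank_fintype_fun_eq_card,
    Set.ncard_eq_toFinset_card', Set.toFinset_card]

end LinearAlgebra

section Boundary

variable {V : Type*} [Fintype V]

theorem sum_sum_eq_zero_of_symm {g : V → V → ZMod 2} (hsymm : ∀ x y, g x y = g y x)
    (hdiag : ∀ x, g x x = 0) : ∑ x, ∑ y, g x y = 0 := by
  rw [← Fintype.sum_prod_type']
  refine sum_involution (fun p _ => p.swap) (fun p _ => ?_) (fun p _ hp hswap => hp ?_)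
    (fun p _ => mem_univ _) fun p _ => p.swap_swap
  · rw [Prod.fst_swap, Prod.snd_swap, hsymm p.2 p.1, CharTwo.add_self_eq_zero]
  · rw [← congrArg Prod.snd hswap, Prod.snd_swap, hdiag]

/-- The boundary map from 1-chains to 0-chains modulo two. -/
def bd₁ : (Sym2 V → ZMod 2) →ₗ[ZMod 2] (V → ZMod 2) where
  toFun z x := ∑ y, z s(x, y)
  map_add' z z' := by ext x; simp [sum_add_distrib]
  map_smul' a z := by ext x; simp [mul_sum]

theorem bd₁_apply (z : Sym2 V → ZMod 2) (x : V) : bd₁ z x = ∑ y, z s(x, y) := rfl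

theorem sum_bd₁ {z : Sym2 V → ZMod 2} (hz : ∀ e, z e ≠ 0 → ¬ e.IsDiag) : ∑ x, bd₁ z x = 0 :=
  sum_sum_eq_zero_of_symm (fun x y => by rw [Sym2.eq_swap])
    fun x => by_contra fun h => hz _ h rfl

variable [DecidableEq V]

/-- The boundary map from 2-chains to 1-chains modulo two, on the full simplex with vertex set
`V`; the chains of a complex are those supported on its simplices. -/
def bd₂ : (Finset V → ZMod 2) →ₗ[ZMod 2] (Sym2 V → ZMod 2) where
  toFun r := Sym2.lift ⟨fun x y => ∑ z, r {x, y, z}, fun x y => by simp_rw [insert_comm x y]⟩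
  map_add' r r' := by
    ext e
    induction e with | _ x y => simp [sum_add_distrib]
  map_smul' a r := by
    ext e
    induction e with | _ x y => simp [mul_sum]

theorem bd₂_apply (r : Finset V → ZMod 2) (x y : V) : bd₂ r s(x, y) = ∑ z, r {x, y, z} := rfl

theorem bd₁_bd₂ {r : Finset V → ZMod 2} (hr : ∀ σ, r σ ≠ 0 → #σ = 3) : bd₁ (bd₂ r) = 0 := by
  ext x
  simp_rw [bd₁_apply, bd₂_apply]
  refine sum_sum_eq_zero_of_symm (fun y z => by rw [pair_comm]) fun y => ?_
  by_contra h
  have h₃ := hr _ h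
  have h₂ := card_le_two (a := x) (b := y)
  rw [pair_eq_singleton] at h₃
  omega

theorem bd₁_single {x y : V} (h : x ≠ y) :
    bd₁ (Pi.single s(x, y) 1) = Pi.single x 1 + Pi.single y 1 := by
  ext w
  rw [bd₁_apply, Pi.add_apply]
  by_cases hx : w = x
  · subst hx
    rw [sum_eq_single y (fun b _ hb => Pi.single_eq_of_ne (by simp [hb, h]) _) (by simp)]
    simp [h]
  by_cases hy : w = y
  · subst hy
    rw [sum_eq_single x (fun b _ hb => Pi.single_eq_of_ne (by simpa [hx]) _) (by simp)]
    simp [hx, Sym2.eq_swap]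
  · simp [hx, hy]

theorem bd₂_single_apply {x y z : V} (hxz : x ≠ z) (hyz : y ≠ z) :
    bd₂ (Pi.single {x, y, z} 1) s(x, y) = 1 := by
  have hne : ∀ w ≠ z, ({x, y, w} : Finset V) ≠ {x, y, z} := by
    intro w hw h
    have hz : z ∈ ({x, y, w} : Finset V) := by simp [h]
    simp [hxz.symm, hyz.symm, hw.symm] at hz
  rw [bd₂_apply, sum_eq_single z (fun w _ hw => Pi.single_eq_of_ne (hne w hw) _) (by simp),
    Pi.single_eq_same]

theorem bd₂_single {x y z : V} (hxy : x ≠ y) (hxz : x ≠ z) (hyz : y ≠ z) :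
    bd₂ (Pi.single {x, y, z} 1) =
      Pi.single s(x, y) 1 + Pi.single s(y, z) 1 + Pi.single s(x, z) 1 := by
  have hbd_yz : bd₂ (Pi.single {x, y, z} 1) s(y, z) = 1 := by
    rw [insert_comm, pair_comm x z]
    exact bd₂_single_apply hxy.symm hxz.symm
  have hbd_xz : bd₂ (Pi.single {x, y, z} 1) s(x, z) = 1 := by
    rw [pair_comm y z]
    exact bd₂_single_apply hxy hyz.symm
  ext e
  by_cases h₁ : e = s(x, y)
  · subst h₁
    simp [bd₂_single_apply, *, hxy.symm]
  by_cases h₂ : e = s(y, z)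
  · subst h₂
    simp [*, hxy.symm]
  by_cases h₃ : e = s(x, z)
  · subst h₃
    simp [*]
  induction e with | _ u v =>
  simp only [Pi.add_apply, Pi.single_eq_of_ne h₁, Pi.single_eq_of_ne h₂, Pi.single_eq_of_ne h₃,
    add_zero, bd₂_apply]
  refine sum_eq_zero fun w _ => Pi.single_eq_of_ne (fun h => ?_) _
  have hcard : #({u, v, w} : Finset V) = 3 := by
    rw [h, card_eq_three]
    exact ⟨x, y, z, hxy, hxz, hyz, rfl⟩
  have huv : u ≠ v := by
    rintro rfl
    have := card_le_two (a := u) (b := w)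
    simp only [mem_insert, mem_singleton, true_or, insert_eq_of_mem] at hcard
    omega
  have hu : u ∈ ({x, y, z} : Finset V) := by simp [← h]
  have hv : v ∈ ({x, y, z} : Finset V) := by simp [← h]
  simp only [mem_insert, mem_singleton] at hu hv
  simp only [Sym2.eq_iff] at h₁ h₂ h₃
  grind

end Boundary

section Disc

variable {V : Type*} {D : AbstractSimplicialComplex V}

theorem adj_of_mem_triangles {σ : Finset V} (hσ : σ ∈ triangles D) {x y : V} (hx : x ∈ σ)
    (hy : y ∈ σ) (hxy : x ≠ y) : (skeleton D).Adj x y := by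
  refine ⟨hxy, (D.isRelLowerSet_faces hσ.1).2 (fun w hw => ?_) (by simp)⟩
  simp only [mem_insert, mem_singleton] at hw
  rcases hw with rfl | rfl <;> assumption

theorem IsDisc.exists_mem_apexes (hD : IsDisc D) {x y : V} (h : (skeleton D).Adj x y) :
    ∃ z, z ∈ apexes D x y := by
  refine Set.nonempty_of_ncard_ne_zero ?_
  have := hD.link_degree x y h
  omega

variable [DecidableEq V]

theorem exists_eq_of_mem_triangles {σ : Finset V} (hσ : σ ∈ triangles D) {x : V} (hx : x ∈ σ) :
    ∃ y z, σ = {x, y, z} ∧ x ≠ y ∧ x ≠ z ∧ y ≠ z := by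
  obtain ⟨y, z, hyz, h⟩ := card_eq_two.1 ((card_erase_of_mem hx).trans (by rw [hσ.2]))
  have hnot := notMem_erase x σ
  rw [h, mem_insert, mem_singleton, not_or] at hnot
  exact ⟨y, z, by rw [← h, insert_erase hx], hnot.1, hnot.2, hyz⟩

theorem mem_apexes_iff {x y z : V} (hxy : x ≠ y) :
    z ∈ apexes D x y ↔ {x, y, z} ∈ triangles D := by
  rw [apexes, triangles, Set.mem_ofPred_eq, Set.mem_ofPred_eq, ← and_assoc, and_comm]
  refine and_congr ?_ ⟨fun h => card_eq_three.2 ⟨x, y, z, hxy, h.1.symm, h.2.symm, rfl⟩, ?_⟩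
  · convert Iff.rfl
  · intro h
    constructor <;> rintro rfl <;> grind

theorem ne_of_mem_triangles {x y z : V} (h : {x, y, z} ∈ triangles D) :
    x ≠ y ∧ x ≠ z ∧ y ≠ z := by
  have := h.2
  refine ⟨?_, ?_, ?_⟩ <;> rintro rfl <;> grind

theorem IsDisc.link_induction (hD : IsDisc D) (x : V) {P : V → Prop} {y₀ : V}
    (h₀ : (skeleton D).Adj x y₀) (hP : P y₀)
    (hstep : ∀ y z, (skeleton D).Adj x y → P y → {x, y, z} ∈ triangles D → P z) {y : V}
    (hy : (skeleton D).Adj x y) : P y := by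
  have hreach := (SimpleGraph.reachable_iff_reflTransGen _ _).1
    ((hD.link_connected x).preconnected ⟨y₀, h₀⟩ ⟨y, hy⟩)
  generalize hb : (⟨y, hy⟩ : (skeleton D).neighborSet x) = b at hreach
  suffices P b by rwa [← hb] at this
  clear hb
  induction hreach with
  | refl => exact hP
  | @tail a b _ hab ih =>
    have ha : (skeleton D).Adj x a := a.2
    have hb : (skeleton D).Adj x b := b.2
    refine hstep a b ha ih ?_
    rw [linkGraph, SimpleGraph.fromRel_adj] at hab
    rcases hab.2 with h | h
    · exact (mem_apexes_iff ha.ne).1 h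
    · rw [pair_comm]
      exact (mem_apexes_iff hb.ne).1 h

variable [Fintype V] {r : Finset V → ZMod 2}

theorem bd₂_mem_supportedOn (hr : r ∈ supportedOn (ZMod 2) (triangles D)) :
    bd₂ r ∈ supportedOn (ZMod 2) (skeleton D).edgeSet := by
  rw [mem_supportedOn] at hr ⊢
  intro e
  induction e with | _ x y =>
  intro he
  refine sum_eq_zero fun z _ => hr _ fun h => he ?_
  exact adj_of_mem_triangles h (by simp) (by simp) (ne_of_mem_triangles h).1

theorem bd₁_bd₂_of_mem (hr : r ∈ supportedOn (ZMod 2) (triangles D)) : bd₁ (bd₂ r) = 0 :=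
  bd₁_bd₂ fun σ h => (not_imp_comm.1 (mem_supportedOn.1 hr σ) h).2

theorem apply_eq_zero_of_boundary (hr : r ∈ supportedOn (ZMod 2) (triangles D)) {x y z : V}
    (hxy : (boundary D).Adj x y) (hbd : bd₂ r s(x, y) = 0) (hz : z ∈ apexes D x y) :
    r {x, y, z} = 0 := by
  obtain ⟨a, ha⟩ := Set.ncard_eq_one.1 hxy.2
  rw [bd₂_apply, Fintype.sum_eq_single a fun w hw => mem_supportedOn.1 hr _ fun h => hw ?_] at hbd
  · rw [ha, Set.mem_singleton_iff] at hz
    rwa [hz]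
  · simpa [ha] using (mem_apexes_iff hxy.1.ne).2 h

theorem IsDisc.apply_eq_apply (hD : IsDisc D) (hr : r ∈ supportedOn (ZMod 2) (triangles D))
    {x y z w : V} (hxy : (skeleton D).Adj x y) (hbd : bd₂ r s(x, y) = 0)
    (hz : z ∈ apexes D x y) (hw : w ∈ apexes D x y) : r {x, y, z} = r {x, y, w} := by
  rcases hD.link_degree x y hxy with hcard | hcard
  · rw [apply_eq_zero_of_boundary hr ⟨hxy, hcard⟩ hbd hz,
      apply_eq_zero_of_boundary hr ⟨hxy, hcard⟩ hbd hw]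
  obtain ⟨a, b, hab, h⟩ := Set.ncard_eq_two.1 hcard
  have hsum : bd₂ r s(x, y) = r {x, y, a} + r {x, y, b} := by
    refine Fintype.sum_eq_add a b hab fun u hu => mem_supportedOn.1 hr _ fun hσ => ?_
    simpa [h, hu.1, hu.2] using (mem_apexes_iff hxy.ne).2 hσ
  rw [hsum, CharTwo.add_eq_zero] at hbd
  rw [h, Set.mem_insert_iff, Set.mem_singleton_iff] at hz hw
  rcases hz with rfl | rfl <;> rcases hw with rfl | rfl <;> simp only [hbd]

theorem IsDisc.apply_eq_of_mem_star (hD : IsDisc D) (hr : r ∈ supportedOn (ZMod 2) (triangles D))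
    {x : V} (hx : ∀ y, bd₂ r s(x, y) = 0) {σ τ : Finset V} (hσ : σ ∈ triangles D)
    (hτ : τ ∈ triangles D) (hxσ : x ∈ σ) (hxτ : x ∈ τ) : r τ = r σ := by
  obtain ⟨y, z, rfl, hxy, -, -⟩ := exists_eq_of_mem_triangles hσ hxσ
  obtain ⟨u, w, rfl, hxu, -, -⟩ := exists_eq_of_mem_triangles hτ hxτ
  have hadj_y := adj_of_mem_triangles hσ hxσ (by simp) hxy
  have hadj_u := adj_of_mem_triangles hτ hxτ (by simp) hxu
  refine hD.link_induction x (P := fun u => ∀ w ∈ apexes D x u, r {x, u, w} = r {x, y, z}) hadj_y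
    (fun w hw => hD.apply_eq_apply hr hadj_y (hx y) hw ((mem_apexes_iff hxy).2 hσ)) ?_ hadj_u w
    ((mem_apexes_iff hxu).2 hτ)
  intro a b hxa ha hab w hw
  obtain ⟨-, hxb, -⟩ := ne_of_mem_triangles hab
  rw [← ha b ((mem_apexes_iff hxa.ne).2 hab), pair_comm a b]
  exact hD.apply_eq_apply hr (adj_of_mem_triangles hab (by simp) (by simp) hxb) (hx b) hw
    ((mem_apexes_iff hxb).2 (by rwa [pair_comm b a]))

theorem IsDisc.eq_zero_of_bd₂_eq_zero (hD : IsDisc D)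
    (hr : r ∈ supportedOn (ZMod 2) (triangles D)) (hbd : bd₂ r = 0) : r = 0 := by
  have hstar (x : V) {σ τ : Finset V} := hD.apply_eq_of_mem_star hr (x := x)
    (fun y => congrFun hbd _) (σ := σ) (τ := τ)
  obtain ⟨x₀, y₀, hxy⟩ := hD.boundary_nonempty
  have hzero : ∀ x, ∀ σ ∈ triangles D, x ∈ σ → r σ = 0 := by
    intro x
    have hreach := (SimpleGraph.reachable_iff_reflTransGen _ _).1 (hD.connected.preconnected x₀ x)
    induction hreach with
    | refl =>
      intro σ hσ hx
      obtain ⟨z, hz⟩ := hD.exists_mem_apexes hxy.1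
      rw [hstar x₀ ((mem_apexes_iff hxy.1.ne).1 hz) hσ (by simp) hx]
      exact apply_eq_zero_of_boundary hr hxy (congrFun hbd _) hz
    | @tail a b _ hab ih =>
      intro σ hσ hb
      obtain ⟨z, hz⟩ := hD.exists_mem_apexes hab
      have hτ := (mem_apexes_iff hab.ne).1 hz
      rw [hstar b hτ hσ (by simp) hb]
      exact ih _ hτ (by simp)
  ext σ
  by_cases hσ : σ ∈ triangles D
  · obtain ⟨x, hx⟩ := card_pos.1 (hσ.2.symm ▸ three_pos)
    exact hzero x σ hσ hx
  · exact mem_supportedOn.1 hr σ hσ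

theorem exists_bd₁_eq_of_reachable {G : SimpleGraph V} {o x : V} (h : G.Reachable o x) :
    ∃ c ∈ supportedOn (ZMod 2) G.edgeSet, bd₁ c = Pi.single x 1 + Pi.single o 1 := by
  replace h := (SimpleGraph.reachable_iff_reflTransGen _ _).1 h
  induction h with
  | refl => exact ⟨0, zero_mem _, by rw [map_zero, ZModModule.add_self]⟩
  | @tail a b _ hab ih =>
    obtain ⟨c, hc, hbd⟩ := ih
    refine ⟨c + Pi.single s(a, b) 1, add_mem hc (mem_supportedOn.2 fun e he => ?_), ?_⟩
    · refine Pi.single_eq_of_ne (fun h => he ?_) _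
      rwa [h]
    · rw [map_add, hbd, bd₁_single hab.ne]
      linear_combination ZModModule.add_self (Pi.single a 1 : V → ZMod 2)

omit [DecidableEq V] in
theorem card_le_finrank_map_bd₁ {G : SimpleGraph V} (hG : G.Connected) :
    Fintype.card V ≤ finrank (ZMod 2) ((supportedOn (ZMod 2) G.edgeSet).map bd₁) + 1 := by
  classical
  obtain ⟨o⟩ := hG.nonempty
  set C := (supportedOn (ZMod 2) G.edgeSet).map bd₁
  set L := Submodule.span (ZMod 2) {(Pi.single o 1 : V → ZMod 2)}
  have htop : C ⊔ L = ⊤ := by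
    rw [eq_top_iff, ← (Pi.basisFun (ZMod 2) V).span_eq, Submodule.span_le]
    rintro _ ⟨x, rfl⟩
    obtain ⟨c, hc, hbd⟩ := exists_bd₁_eq_of_reachable (hG.preconnected o x)
    have hsum : Pi.basisFun (ZMod 2) V x = bd₁ c + Pi.single o 1 := by
      rw [hbd, Pi.basisFun_apply, add_assoc, ZModModule.add_self, add_zero]
    rw [hsum]
    exact Submodule.add_mem_sup ⟨c, hc, rfl⟩ (Submodule.mem_span_singleton_self _)
  calc Fintype.card V = finrank (ZMod 2) ↥(C ⊔ L) := by
        rw [htop, finrank_top, finrank_fintype_fun_eq_card]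
    _ ≤ finrank (ZMod 2) C + finrank (ZMod 2) L :=
        Submodule.finrank_add_le_finrank_add_finrank _ _
    _ ≤ finrank (ZMod 2) C + 1 := by
        gcongr
        exact (finrank_span_le_card _).trans (by simp)

theorem IsDisc.exists_bd₂_eq (hD : IsDisc D) {z : Sym2 V → ZMod 2}
    (hz : z ∈ supportedOn (ZMod 2) (skeleton D).edgeSet) (hbd : bd₁ z = 0) :
    ∃ r ∈ supportedOn (ZMod 2) (triangles D), bd₂ r = z := by
  suffices h : (supportedOn (ZMod 2) (triangles D)).map bd₂ =
      supportedOn (ZMod 2) (skeleton D).edgeSet ⊓ LinearMap.ker bd₁ by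
    rw [← Submodule.mem_map, h]
    exact ⟨hz, hbd⟩
  apply map_eq_inf_ker_of_finrank
  · rintro _ ⟨r, hr, rfl⟩
    exact ⟨bd₂_mem_supportedOn hr, bd₁_bd₂_of_mem hr⟩
  · rw [eq_bot_iff]
    exact fun r hr => hD.eq_zero_of_bd₂_eq_zero hr.1 hr.2
  · rw [finrank_fintype_fun_eq_card]
    exact card_le_finrank_map_bd₁ hD.connected
  · have heuler := hD.euler
    rw [finrank_supportedOn, finrank_supportedOn, finrank_fintype_fun_eq_card,
      ← Nat.card_eq_fintype_card]
    omega

end Disc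

section Circuit

variable {V : Type*} {G : SimpleGraph V} {f : ℕ → V} {N : ℕ}

/-- The closed walk `f 0, f 1, …, f N = f 0` is a circuit: its vertices `f 0, …, f (N - 1)` are
distinct and there are at least three of them. -/
structure IsCircuit (G : SimpleGraph V) (f : ℕ → V) (N : ℕ) : Prop where
  three_le : 3 ≤ N
  adj : ∀ j < N, G.Adj (f j) (f (j + 1))
  closed : f N = f 0
  injOn : Set.InjOn f (Set.Iio N)

theorem IsCircuit.eq_or (hf : IsCircuit G f N) {i j : ℕ} (hi : i ≤ N) (hj : j ≤ N)
    (h : f i = f j) : i = j ∨ i = 0 ∧ j = N ∨ i = N ∧ j = 0 := by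
  have hclosed := hf.closed
  have hthree := hf.three_le
  rcases hi.lt_or_eq with hi | rfl <;> rcases hj.lt_or_eq with hj | rfl
  · exact .inl (hf.injOn hi hj h)
  · exact .inr (.inl ⟨hf.injOn hi (by grind) (h.trans hclosed), rfl⟩)
  · exact .inr (.inr ⟨rfl, (hf.injOn (by grind) hj (hclosed.symm.trans h)).symm⟩)
  · exact .inl rfl

theorem IsCircuit.edge_injOn (hf : IsCircuit G f N) :
    Set.InjOn (fun j => s(f j, f (j + 1))) (range N) := by
  intro i hi j hj h
  rw [coe_range, Set.mem_Iio] at hi hj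
  have hthree := hf.three_le
  rcases Sym2.eq_iff.1 h with ⟨h, -⟩ | ⟨h₁, h₂⟩
  · exact hf.injOn hi hj h
  · have h₁ := hf.eq_or hi.le hj h₁
    have h₂ := hf.eq_or hi hj.le h₂
    omega

theorem IsCircuit.eq_or_eq_of_mk_eq (hf : IsCircuit G f N) {i j : ℕ} (hi : i < N) (hj : j + 1 < N)
    {y : V} (h : s(f (j + 1), y) = s(f i, f (i + 1))) : y = f j ∨ y = f (j + 2) := by
  have := hf.three_le
  rcases Sym2.eq_iff.1 h with ⟨hij, rfl⟩ | ⟨hij, rfl⟩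
  · have := hf.eq_or (by omega) (by omega) hij
    exact .inr (congrArg f (by omega))
  · have := hf.eq_or (by omega) (by omega) hij
    exact .inl (congrArg f (by omega))

theorem IsCircuit.apply_ne_apply_add_two (hf : IsCircuit G f N) {j : ℕ} (hj : j + 1 < N) :
    f j ≠ f (j + 2) := by
  intro h
  have := hf.eq_or (by omega) (by omega) h
  have := hf.three_le
  omega

theorem IsCircuit.bd₁_apply [Fintype V] (hf : IsCircuit G f N) {z : Sym2 V → ZMod 2}
    (hz : z ∈ supportedOn (ZMod 2) {e | ∃ j < N, e = s(f j, f (j + 1))}) {j : ℕ}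
    (hj : j + 1 < N) : bd₁ z (f (j + 1)) =
      z s(f j, f (j + 1)) + z s(f (j + 1), f (j + 1 + 1)) := by
  rw [Sym2.eq_swap (a := f j)]
  refine Fintype.sum_eq_add _ _ (hf.apply_ne_apply_add_two hj) fun y hy =>
    mem_supportedOn.1 hz _ ?_
  rintro ⟨i, hi, h⟩
  exact (hf.eq_or_eq_of_mk_eq hi hj h).elim hy.1 hy.2

theorem IsCircuit.update (hf : IsCircuit G f N) {j : ℕ} (hj : j + 1 < N) {w : V}
    (haw : G.Adj (f j) w) (hwb : G.Adj w (f (j + 2))) (hw : ∀ i < N, f i ≠ w) :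
    IsCircuit G (Function.update f (j + 1) w) N where
  three_le := hf.three_le
  adj i hi := by
    have := hf.adj i hi
    grind
  closed := by
    rw [Function.update_of_ne (by omega), Function.update_of_ne (by omega), hf.closed]
  injOn i hi k hk h := by
    have hinj := hf.injOn hi hk
    have hwi := hw i hi
    have hwk := hw k hk
    grind

variable [DecidableEq V]

/-- The 1-chain modulo two of the first `N` edges of the walk `f`. -/
def edgeChain (f : ℕ → V) (N : ℕ) : Sym2 V → ZMod 2 :=
  ∑ j ∈ range N, Pi.single s(f j, f (j + 1)) 1

theorem edgeChain_mem_supportedOn (f : ℕ → V) (N : ℕ) :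
    edgeChain f N ∈ supportedOn (ZMod 2) {e | ∃ j < N, e = s(f j, f (j + 1))} := by
  refine sum_mem fun j hj => mem_supportedOn.2 fun e he => Pi.single_eq_of_ne ?_ _
  rintro rfl
  exact he ⟨j, mem_range.1 hj, rfl⟩

theorem edgeChain_apply_eq_zero {x y : V} (hx : ∀ j ≤ N, f j ≠ x) : edgeChain f N s(x, y) = 0 := by
  refine mem_supportedOn.1 (edgeChain_mem_supportedOn f N) _ ?_
  rintro ⟨j, hj, h⟩
  rcases Sym2.eq_iff.1 h with ⟨h, -⟩ | ⟨h, -⟩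
  · exact hx j hj.le h.symm
  · exact hx (j + 1) hj h.symm

theorem IsCircuit.edgeChain_apply (hf : IsCircuit G f N) {j : ℕ} (hj : j < N) :
    edgeChain f N s(f j, f (j + 1)) = 1 := by
  rw [edgeChain, Finset.sum_apply, sum_eq_single j, Pi.single_eq_same]
  · exact fun i hi hij => Pi.single_eq_of_ne (fun h => hij (hf.edge_injOn hi (by simpa) h.symm)) _
  · simp [hj]

theorem IsCircuit.edgeChain_mem_edgeSet (hf : IsCircuit G f N) :
    edgeChain f N ∈ supportedOn (ZMod 2) G.edgeSet := by
  refine mem_supportedOn.2 fun e he => mem_supportedOn.1 (edgeChain_mem_supportedOn f N) e ?_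
  rintro ⟨j, hj, rfl⟩
  exact he (hf.adj j hj)

theorem edgeChain_update {j : ℕ} (hj : j + 1 < N) (w : V) :
    edgeChain (Function.update f (j + 1) w) N + edgeChain f N =
      (Pi.single s(f j, w) 1 + Pi.single s(f j, f (j + 1)) 1) +
        (Pi.single s(w, f (j + 2)) 1 + Pi.single s(f (j + 1), f (j + 2)) 1) := by
  rw [edgeChain, edgeChain, ← sum_add_distrib, sum_eq_add_of_mem j (j + 1) (by simp; omega)
    (by simpa) (by omega)]
  · simp
  · intro i _ hi
    rw [Function.update_of_ne (by omega), Function.update_of_ne (by omega), ZModModule.add_self]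

variable [Fintype V]

theorem bd₁_edgeChain (hne : ∀ j < N, f j ≠ f (j + 1)) :
    bd₁ (edgeChain f N) = Pi.single (f 0) 1 + Pi.single (f N) 1 := by
  induction N with
  | zero => rw [edgeChain, sum_range_zero, map_zero, ZModModule.add_self]
  | succ N ih =>
    rw [edgeChain, sum_range_succ, ← edgeChain, map_add, ih fun j hj => hne j (by omega),
      bd₁_single (hne N (by omega))]
    linear_combination ZModModule.add_self (Pi.single (f N) 1 : V → ZMod 2)

theorem IsCircuit.bd₁_edgeChain (hf : IsCircuit G f N) : bd₁ (edgeChain f N) = 0 := by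
  rw [STUniform.bd₁_edgeChain fun j hj => (hf.adj j hj).ne, hf.closed, ZModModule.add_self]

theorem IsCircuit.eq_zero_or_eq_edgeChain (hf : IsCircuit G f N) {z : Sym2 V → ZMod 2}
    (hz : z ∈ supportedOn (ZMod 2) {e | ∃ j < N, e = s(f j, f (j + 1))}) (hbd : bd₁ z = 0) :
    z = 0 ∨ z = edgeChain f N := by
  have hconst : ∀ j < N, z s(f j, f (j + 1)) = z s(f 0, f 1) := by
    intro j
    induction j with
    | zero => exact fun _ => rfl
    | succ j ih =>
      intro hj
      have hsum := hf.bd₁_apply hz hj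
      rw [hbd, Pi.zero_apply, eq_comm, CharTwo.add_eq_zero, ih (by omega)] at hsum
      exact hsum.symm
  have hext : ∀ z' ∈ supportedOn (ZMod 2) {e | ∃ j < N, e = s(f j, f (j + 1))},
      (∀ j < N, z' s(f j, f (j + 1)) = z s(f 0, f 1)) → z = z' := by
    intro z' hz' h
    ext e
    by_cases he : ∃ j < N, e = s(f j, f (j + 1))
    · obtain ⟨j, hj, rfl⟩ := he
      rw [hconst j hj, h j hj]
    · rw [mem_supportedOn.1 hz e he, mem_supportedOn.1 hz' e he]
  rcases Fin.exists_fin_two.1 ⟨z s(f 0, f 1), rfl⟩ with h | h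
  · exact .inl (hext 0 (zero_mem _) fun _ _ => h.symm)
  · exact .inr (hext _ (edgeChain_mem_supportedOn f N) fun j hj =>
      (hf.edgeChain_apply hj).trans h.symm)

end Circuit

section Region

variable {V : Type*} {D : AbstractSimplicialComplex V} {r : Finset V → ZMod 2}

theorem IsDisc.ncard_apexes_of_isInterior (hD : IsDisc D) {x y : V} (hx : IsInterior D x)
    (h : (skeleton D).Adj x y) : (apexes D x y).ncard = 2 :=
  (hD.link_degree x y h).resolve_left fun h₁ => hx ⟨y, h, h₁⟩

theorem exists_eq_of_mem_of_mem_triangles [DecidableEq V] {σ : Finset V} (hσ : σ ∈ triangles D)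
    {x y : V} (hx : x ∈ σ) (hy : y ∈ σ) (hxy : x ≠ y) :
    ∃ z, σ = {x, y, z} ∧ x ≠ z ∧ y ≠ z := by
  obtain ⟨a, b, rfl, hxa, hxb, hab⟩ := exists_eq_of_mem_triangles hσ hx
  rcases (by simpa [hxy.symm] using hy : y = a ∨ y = b) with rfl | rfl
  · exact ⟨b, rfl, hxb, hab⟩
  · exact ⟨a, by rw [pair_comm], hxa, hab.symm⟩

variable [Fintype V]

/-- The region of a 2-chain modulo two: the 2-simplices which occur in it. -/
def cells (r : Finset V → ZMod 2) : Finset (Finset V) := {σ | r σ ≠ 0}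

theorem mem_cells {σ : Finset V} : σ ∈ cells r ↔ r σ ≠ 0 := by simp [cells]

theorem mem_triangles_of_mem_cells (hr : r ∈ supportedOn (ZMod 2) (triangles D)) {σ : Finset V}
    (hσ : σ ∈ cells r) : σ ∈ triangles D :=
  not_imp_comm.1 (mem_supportedOn.1 hr σ) (mem_cells.1 hσ)

theorem eq_one_of_mem_cells {σ : Finset V} (hσ : σ ∈ cells r) : r σ = 1 :=
  (Fin.exists_fin_two.1 ⟨r σ, rfl⟩).resolve_left (mem_cells.1 hσ)

variable [DecidableEq V]

/-- The 2-simplices of the region of `r` which contain the vertex `x`. -/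
def starCells (r : Finset V → ZMod 2) (x : V) : Finset (Finset V) := {σ ∈ cells r | x ∈ σ}

/-- The 2-simplices of the region of `r` which contain the edge `e`. -/
def edgeCells (r : Finset V → ZMod 2) (e : Sym2 V) : Finset (Finset V) :=
  {σ ∈ cells r | e ∈ σ.sym2}

/-- The edges of the region of `r`. -/
def cellEdges (r : Finset V → ZMod 2) : Finset (Sym2 V) :=
  {e | ¬ e.IsDiag ∧ (edgeCells r e).Nonempty}

/-- The vertices of the region of `r`. -/
def cellVerts (r : Finset V → ZMod 2) : Finset V := {x | (starCells r x).Nonempty}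

theorem mem_starCells {σ : Finset V} {x : V} : σ ∈ starCells r x ↔ σ ∈ cells r ∧ x ∈ σ := by
  simp [starCells]

theorem mem_edgeCells {σ : Finset V} {x y : V} :
    σ ∈ edgeCells r s(x, y) ↔ σ ∈ cells r ∧ x ∈ σ ∧ y ∈ σ := by
  simp [edgeCells]

theorem card_edgeCells (hr : r ∈ supportedOn (ZMod 2) (triangles D)) {x y : V} (hxy : x ≠ y) :
    #(edgeCells r s(x, y)) = #{z | r {x, y, z} ≠ 0} := by
  symm
  refine card_bij (fun z _ => {x, y, z}) (fun z hz => ?_) (fun z hz w _ h => ?_) fun σ hσ => ?_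
  · exact mem_edgeCells.2 ⟨mem_cells.2 (mem_filter.1 hz).2, by simp, by simp⟩
  · obtain ⟨-, hxz, hyz⟩ := ne_of_mem_triangles (mem_triangles_of_mem_cells hr
      (mem_cells.2 (mem_filter.1 hz).2))
    have hmem : z ∈ ({x, y, w} : Finset V) := h ▸ by simp
    simpa [hxz.symm, hyz.symm] using hmem
  · obtain ⟨hσ, hx, hy⟩ := mem_edgeCells.1 hσ
    obtain ⟨z, rfl, -⟩ :=
      exists_eq_of_mem_of_mem_triangles (mem_triangles_of_mem_cells hr hσ) hx hy hxy
    exact ⟨z, by simpa using mem_cells.1 hσ, rfl⟩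

theorem bd₂_apply_eq_card (hr : r ∈ supportedOn (ZMod 2) (triangles D)) {x y : V} (hxy : x ≠ y) :
    bd₂ r s(x, y) = #(edgeCells r s(x, y)) := by
  rw [card_edgeCells hr hxy, card_eq_sum_ones, Nat.cast_sum, sum_filter, bd₂_apply]
  refine sum_congr rfl fun z _ => ?_
  split_ifs with h
  · simpa using eq_one_of_mem_cells (mem_cells.2 h)
  · simpa using h

theorem IsDisc.card_edgeCells_le (hD : IsDisc D) (hr : r ∈ supportedOn (ZMod 2) (triangles D))
    {x y : V} (h : (skeleton D).Adj x y) : #(edgeCells r s(x, y)) ≤ 2 := by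
  rw [card_edgeCells hr h.ne, ← Set.ncard_coe_finset]
  refine (Set.ncard_le_ncard (t := apexes D x y) (fun z hz => ?_) (Set.toFinite _)).trans ?_
  · exact (mem_apexes_iff h.ne).2 (mem_triangles_of_mem_cells hr (mem_cells.2 (by simpa using hz)))
  · have := hD.link_degree x y h
    omega

theorem card_filter_mem_edgeCells (hr : r ∈ supportedOn (ZMod 2) (triangles D)) {σ : Finset V}
    (hσ : σ ∈ cells r) : #{e ∈ cellEdges r | σ ∈ edgeCells r e} = 3 := by
  have h : {e ∈ cellEdges r | σ ∈ edgeCells r e} = σ.offDiag.image Sym2.mk.uncurry := by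
    ext e
    induction e with | _ x y =>
    simp only [cellEdges, mem_filter, mem_univ, true_and, mem_edgeCells, mem_image, mem_offDiag,
      Prod.exists, Function.uncurry_apply_pair, Sym2.mk_isDiag_iff]
    constructor
    · exact fun h => ⟨x, y, ⟨h.2.2.1, h.2.2.2, h.1.1⟩, rfl⟩
    · rintro ⟨a, b, ⟨ha, hb, hab⟩, h⟩
      rw [Sym2.eq_iff] at h
      refine ⟨⟨by grind, σ, mem_edgeCells.2 ?_⟩, ?_⟩ <;> grind
  rw [h, Sym2.card_image_offDiag, (mem_triangles_of_mem_cells hr hσ).2, Nat.choose_two_right]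

theorem sum_card_edgeCells (hr : r ∈ supportedOn (ZMod 2) (triangles D)) :
    ∑ e ∈ cellEdges r, #(edgeCells r e) = 3 * #(cells r) := by
  calc ∑ e ∈ cellEdges r, #(edgeCells r e)
      = ∑ e ∈ cellEdges r, #((cells r).bipartiteAbove (fun e σ => σ ∈ edgeCells r e) e) := by
        refine sum_congr rfl fun e _ => congrArg card ?_
        ext σ
        simp +contextual [bipartiteAbove, edgeCells]
    _ = ∑ σ ∈ cells r, #((cellEdges r).bipartiteBelow (fun e σ => σ ∈ edgeCells r e) σ) :=
        sum_card_bipartiteAbove_eq_sum_card_bipartiteBelow _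
    _ = 3 * #(cells r) := by
        simp_rw [bipartiteBelow]
        rw [sum_congr rfl fun σ hσ => card_filter_mem_edgeCells hr hσ, sum_const, smul_eq_mul,
          mul_comm]

theorem sum_card_starCells (hr : r ∈ supportedOn (ZMod 2) (triangles D)) :
    ∑ x ∈ cellVerts r, #(starCells r x) = 3 * #(cells r) := by
  calc ∑ x ∈ cellVerts r, #(starCells r x)
      = ∑ σ ∈ cells r, #((cellVerts r).bipartiteBelow (fun x σ => x ∈ σ) σ) :=
        sum_card_bipartiteAbove_eq_sum_card_bipartiteBelow _
    _ = ∑ σ ∈ cells r, #σ := by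
        refine sum_congr rfl fun σ hσ => congrArg card ?_
        ext x
        simp only [bipartiteBelow, cellVerts, mem_filter, mem_univ, true_and, and_iff_right_iff_imp]
        exact fun hx => ⟨σ, mem_starCells.2 ⟨hσ, hx⟩⟩
    _ = 3 * #(cells r) := by
        rw [sum_congr rfl fun σ hσ => (mem_triangles_of_mem_cells hr hσ).2, sum_const,
          smul_eq_mul, mul_comm]

theorem two_mul_card_starCells (hr : r ∈ supportedOn (ZMod 2) (triangles D)) (x : V)
    [DecidableRel (skeleton D).Adj] :
    2 * #(starCells r x) = ∑ y ∈ (skeleton D).neighborFinset x, #(edgeCells r s(x, y)) := by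
  set nbrs := (skeleton D).neighborFinset x
  calc 2 * #(starCells r x)
      = ∑ σ ∈ starCells r x, #(nbrs.bipartiteBelow (fun y σ => y ∈ σ) σ) := by
        rw [mul_comm, ← smul_eq_mul, ← sum_const]
        refine sum_congr rfl fun σ hσ => ?_
        obtain ⟨hσ, hx⟩ := mem_starCells.1 hσ
        have hσ := mem_triangles_of_mem_cells hr hσ
        have h : nbrs.bipartiteBelow (fun y σ => y ∈ σ) σ = σ.erase x := by
          ext y
          rw [mem_bipartiteBelow, SimpleGraph.mem_neighborFinset, mem_erase]
          exact ⟨fun h => ⟨h.1.ne', h.2⟩, fun h => ⟨adj_of_mem_triangles hσ hx h.2 h.1.symm, h.2⟩⟩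
        rw [h, card_erase_of_mem hx, hσ.2]
    _ = ∑ y ∈ nbrs, #((starCells r x).bipartiteAbove (fun y σ => y ∈ σ) y) :=
        (sum_card_bipartiteAbove_eq_sum_card_bipartiteBelow _).symm
    _ = ∑ y ∈ nbrs, #(edgeCells r s(x, y)) := by
        refine sum_congr rfl fun y _ => congrArg card ?_
        ext σ
        rw [mem_bipartiteAbove, mem_starCells, mem_edgeCells, and_assoc]

theorem IsDisc.isInterior_of_bd₂_eq_zero (hD : IsDisc D)
    (hr : r ∈ supportedOn (ZMod 2) (triangles D)) {x : V} (hbd : ∀ y, bd₂ r s(x, y) = 0)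
    (hx : (starCells r x).Nonempty) : IsInterior D x := by
  rintro ⟨y, hxy⟩
  obtain ⟨σ, hσ⟩ := hx
  obtain ⟨hσ, hx⟩ := mem_starCells.1 hσ
  obtain ⟨z, hz⟩ := hD.exists_mem_apexes hxy.1
  have hτ := (mem_apexes_iff hxy.1.ne).1 hz
  apply mem_cells.1 hσ
  rw [hD.apply_eq_of_mem_star hr hbd hτ (mem_triangles_of_mem_cells hr hσ) (by simp) hx]
  exact apply_eq_zero_of_boundary hr hxy (hbd y) hz

theorem IsDisc.card_starCells_eq_degree (hD : IsDisc D)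
    (hr : r ∈ supportedOn (ZMod 2) (triangles D)) {x : V} (hbd : ∀ y, bd₂ r s(x, y) = 0)
    (hx : (starCells r x).Nonempty) :
    #(starCells r x) = ((skeleton D).neighborSet x).ncard := by
  classical
  have hinterior := hD.isInterior_of_bd₂_eq_zero hr hbd hx
  obtain ⟨σ, hσ⟩ := hx
  obtain ⟨hσ, hx⟩ := mem_starCells.1 hσ
  have hedge : ∀ y ∈ (skeleton D).neighborFinset x, #(edgeCells r s(x, y)) = 2 := by
    intro y hy
    rw [SimpleGraph.mem_neighborFinset] at hy
    rw [card_edgeCells hr hy.ne, ← Set.ncard_coe_finset]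
    refine (congrArg Set.ncard ?_).trans (hD.ncard_apexes_of_isInterior hinterior hy)
    ext z
    rw [mem_coe, mem_filter, mem_apexes_iff hy.ne]
    refine ⟨fun h => mem_triangles_of_mem_cells hr (mem_cells.2 h.2), fun h => ⟨mem_univ z, ?_⟩⟩
    rw [hD.apply_eq_of_mem_star hr hbd (mem_triangles_of_mem_cells hr hσ) h hx (by simp)]
    exact mem_cells.1 hσ
  have hcount := two_mul_card_starCells hr x
  rw [sum_congr rfl hedge, sum_const, smul_eq_mul, mul_comm] at hcount
  rw [Nat.eq_of_mul_eq_mul_right two_pos hcount, ← Set.ncard_coe_finset,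
    SimpleGraph.coe_neighborFinset]

theorem map_bd₁_cellEdges_lt (hr : r ∈ supportedOn (ZMod 2) (triangles D)) (hne : r ≠ 0) :
    (supportedOn (ZMod 2) (cellEdges r : Set (Sym2 V))).map bd₁ <
      supportedOn (ZMod 2) (cellVerts r : Set V) := by
  obtain ⟨σ, hσ⟩ := Function.ne_iff.1 hne
  obtain ⟨x, hx⟩ := card_pos.1 ((mem_triangles_of_mem_cells hr (mem_cells.2 hσ)).2.symm ▸ three_pos)
  refine SetLike.lt_iff_le_and_exists.2 ⟨?_, Pi.single x 1, ?_, ?_⟩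
  · rintro _ ⟨z, hz, rfl⟩
    refine mem_supportedOn.2 fun y hy => sum_eq_zero fun w _ =>
      mem_supportedOn.1 hz _ fun h => hy ?_
    obtain ⟨τ, hτ⟩ := (mem_filter.1 (mem_coe.1 h)).2.2
    obtain ⟨hτ, hyτ, -⟩ := mem_edgeCells.1 hτ
    simpa [cellVerts] using ⟨τ, mem_starCells.2 ⟨hτ, hyτ⟩⟩
  · refine mem_supportedOn.2 fun y hy => Pi.single_eq_of_ne ?_ _
    rintro rfl
    exact hy (by simpa [cellVerts] using ⟨σ, mem_starCells.2 ⟨mem_cells.2 hσ, hx⟩⟩)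
  · rintro ⟨z, hz, h⟩
    have hsum := sum_bd₁ (z := z) fun e he =>
      (mem_filter.1 (not_imp_comm.1 (mem_supportedOn.1 hz e) he)).2.1
    simp [h] at hsum

theorem mem_edgeSet_of_mem_cellEdges (hr : r ∈ supportedOn (ZMod 2) (triangles D)) {e : Sym2 V}
    (he : e ∈ cellEdges r) : e ∈ (skeleton D).edgeSet := by
  induction e with | _ x y =>
  obtain ⟨-, hne, σ, hσ⟩ := mem_filter.1 he
  obtain ⟨hσ, hx, hy⟩ := mem_edgeCells.1 hσ
  exact adj_of_mem_triangles (mem_triangles_of_mem_cells hr hσ) hx hy hne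

theorem IsDisc.bd₂_mul_one_sub_eq_zero (hD : IsDisc D) {p : Finset V → ZMod 2}
    (hr : r ∈ supportedOn (ZMod 2) (triangles D)) (hp : p ∈ supportedOn (ZMod 2) (triangles D))
    (hpr : bd₂ p ∈ supportedOn (ZMod 2) (cellEdges r : Set (Sym2 V))) {x y : V}
    (hbd : bd₂ r s(x, y) = 0) : bd₂ (p * (1 - r)) s(x, y) = 0 := by
  by_cases he : s(x, y) ∈ cellEdges r
  · obtain ⟨-, hxy, σ, hσ⟩ := mem_filter.1 he
    rw [Sym2.mk_isDiag_iff] at hxy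
    obtain ⟨z, hz⟩ := card_pos.1 (card_edgeCells hr hxy ▸ card_pos.2 ⟨σ, hσ⟩)
    have hz := mem_cells.2 (mem_filter.1 hz).2
    refine sum_eq_zero fun w _ => ?_
    by_cases hw : {x, y, w} ∈ triangles D
    · have hrw : r {x, y, w} = 1 := by
        rw [← eq_one_of_mem_cells hz]
        exact hD.apply_eq_apply hr (mem_edgeSet_of_mem_cellEdges hr he) hbd
          ((mem_apexes_iff hxy).2 hw)
          ((mem_apexes_iff hxy).2 (mem_triangles_of_mem_cells hr hz))
      simp [hrw]
    · rw [Pi.mul_apply, mem_supportedOn.1 hp _ hw, zero_mul]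
  · have hr₀ : ∀ z, r {x, y, z} = 0 := fun z => by
      by_contra hz
      have hz := mem_cells.2 hz
      refine he (mem_filter.2 ⟨mem_univ _, ?_, _, mem_edgeCells.2 ⟨hz, by simp, by simp⟩⟩)
      exact (ne_of_mem_triangles (mem_triangles_of_mem_cells hr hz)).1
    rw [← mem_supportedOn.1 hpr _ he, bd₂_apply, bd₂_apply]
    exact sum_congr rfl fun z _ => by rw [Pi.mul_apply, Pi.sub_apply, hr₀ z]; simp

/-- The circuit `f 0, …, f N = f 0` of `D` encloses the region of the 2-chain `r`: modulo two, its
edges form the boundary of `r`. -/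
structure IsEnclosed (D : AbstractSimplicialComplex V) (f : ℕ → V) (N : ℕ)
    (r : Finset V → ZMod 2) : Prop where
  circuit : IsCircuit (skeleton D) f N
  chain_mem : r ∈ supportedOn (ZMod 2) (triangles D)
  bd₂_eq : bd₂ r = edgeChain f N

theorem IsDisc.exists_isEnclosed (hD : IsDisc D) {f : ℕ → V} {N : ℕ}
    (hf : IsCircuit (skeleton D) f N) : ∃ r, IsEnclosed D f N r := by
  obtain ⟨r, hr, hbd⟩ := hD.exists_bd₂_eq hf.edgeChain_mem_edgeSet hf.bd₁_edgeChain
  exact ⟨r, hf, hr, hbd⟩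

theorem IsDisc.exists_bd₂_eq_of_cellEdges (hD : IsDisc D) {f : ℕ → V} {N : ℕ}
    (hf : IsEnclosed D f N r) {z : Sym2 V → ZMod 2}
    (hz : z ∈ supportedOn (ZMod 2) (cellEdges r : Set (Sym2 V))) (hz₁ : bd₁ z = 0) :
    ∃ p ∈ supportedOn (ZMod 2) (cells r : Set (Finset V)), bd₂ p = z := by
  obtain ⟨p, hp, rfl⟩ := hD.exists_bd₂_eq
    (mem_supportedOn.2 fun e he => mem_supportedOn.1 hz e fun h => he
      (mem_edgeSet_of_mem_cellEdges hf.chain_mem h)) hz₁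
  -- The part of `p` outside the region is a chain whose boundary lies on the circuit.
  have hq : p * (1 - r) ∈ supportedOn (ZMod 2) (triangles D) := mem_supportedOn.2 fun σ hσ => by
    rw [Pi.mul_apply, mem_supportedOn.1 hp σ hσ, zero_mul]
  have hq_bd : bd₂ (p * (1 - r)) ∈ supportedOn (ZMod 2) {e | ∃ j < N, e = s(f j, f (j + 1))} := by
    refine mem_supportedOn.2 fun e he => ?_
    induction e with | _ x y =>
    refine hD.bd₂_mul_one_sub_eq_zero hf.chain_mem hp hz ?_
    rw [hf.bd₂_eq]
    exact mem_supportedOn.1 (edgeChain_mem_supportedOn f N) _ he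
  refine ⟨p, mem_supportedOn.2 fun σ hσ => ?_, rfl⟩
  have hσ : r σ = 0 := by simpa [mem_cells] using hσ
  have hpσ : p σ = (p * (1 - r)) σ := by rw [Pi.mul_apply, Pi.sub_apply, hσ]; simp
  rw [hpσ]
  rcases hf.circuit.eq_zero_or_eq_edgeChain hq_bd (bd₁_bd₂_of_mem hq) with h | h
  · rw [hD.eq_zero_of_bd₂_eq_zero hq h, Pi.zero_apply]
  · have hqr := hD.eq_zero_of_bd₂_eq_zero (sub_mem hq hf.chain_mem)
      (by rw [map_sub, h, hf.bd₂_eq, sub_self])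
    rw [sub_eq_zero.1 hqr, hσ]

end Region

section GaussBonnet

variable {V : Type*} [Fintype V] [DecidableEq V] {D : AbstractSimplicialComplex V} {f : ℕ → V}
  {N : ℕ} {r : Finset V → ZMod 2}

theorem IsEnclosed.ne_zero (hf : IsEnclosed D f N r) : r ≠ 0 := by
  rintro rfl
  have hthree := hf.circuit.three_le
  have h := hf.circuit.edgeChain_apply (j := 0) (by omega)
  rw [← hf.bd₂_eq, map_zero, Pi.zero_apply] at h
  exact zero_ne_one h

theorem IsEnclosed.odd_card_edgeCells (hf : IsEnclosed D f N r) {j : ℕ} (hj : j < N) :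
    Odd #(edgeCells r s(f j, f (j + 1))) := by
  rw [← ZMod.natCast_eq_one_iff_odd, ← bd₂_apply_eq_card hf.chain_mem
    (hf.circuit.adj j hj).ne, hf.bd₂_eq, hf.circuit.edgeChain_apply hj]

theorem IsEnclosed.mem_cellEdges (hf : IsEnclosed D f N r) {j : ℕ} (hj : j < N) :
    s(f j, f (j + 1)) ∈ cellEdges r :=
  mem_filter.2 ⟨mem_univ _, (hf.circuit.adj j hj).ne, card_pos.1 (hf.odd_card_edgeCells hj).pos⟩

theorem IsEnclosed.starCells_nonempty (hf : IsEnclosed D f N r) {j : ℕ} (hj : j < N) :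
    (starCells r (f j)).Nonempty := by
  obtain ⟨σ, hσ⟩ := (mem_filter.1 (hf.mem_cellEdges hj)).2.2
  exact ⟨σ, mem_starCells.2 ⟨(mem_edgeCells.1 hσ).1, (mem_edgeCells.1 hσ).2.1⟩⟩

theorem IsEnclosed.card_cellEdges_add_one_le (hf : IsEnclosed D f N r) (hD : IsDisc D) :
    #(cellEdges r) + 1 ≤ #(cellVerts r) + #(cells r) := by
  have h := finrank_add_one_le_of_inf_ker_le
    (map_bd₁_cellEdges_lt hf.chain_mem hf.ne_zero) (d₂ := bd₂)
    (C₂ := supportedOn (ZMod 2) (cells r : Set (Finset V)))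
    fun z hz => hD.exists_bd₂_eq_of_cellEdges hf hz.1 hz.2
  simpa only [finrank_supportedOn, Set.ncard_coe_finset] using h

theorem IsEnclosed.three_mul_card_cells_add_le (hf : IsEnclosed D f N r) (hD : IsDisc D) :
    3 * #(cells r) + N ≤ 2 * #(cellEdges r) := by
  set C := (range N).image fun j => s(f j, f (j + 1))
  have hCN : #C = N := (card_image_of_injOn hf.circuit.edge_injOn).trans (card_range N)
  have hsub : C ⊆ cellEdges r := image_subset_iff.2 fun j hj => hf.mem_cellEdges (mem_range.1 hj)
  have hle : ∀ e ∈ cellEdges r, #(edgeCells r e) + (if e ∈ C then 1 else 0) ≤ 2 := by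
    intro e he
    have htwo : #(edgeCells r e) ≤ 2 := by
      have hadj := mem_edgeSet_of_mem_cellEdges hf.chain_mem he
      induction e with | _ x y => exact hD.card_edgeCells_le hf.chain_mem hadj
    split_ifs with heC
    · obtain ⟨j, hj, rfl⟩ := mem_image.1 heC
      have hodd := hf.odd_card_edgeCells (mem_range.1 hj)
      grind
    · exact htwo
  have hsum := sum_le_sum hle
  rwa [sum_add_distrib, sum_card_edgeCells hf.chain_mem, sum_ite_mem,
    inter_eq_right.2 hsub, sum_const, sum_const, smul_eq_mul, smul_eq_mul, hCN, mul_one,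
    mul_comm _ 2] at hsum

theorem IsEnclosed.six_add_sum_card_starCells_le (hf : IsEnclosed D f N r) (hD : IsDisc D)
    (hdeg : ∀ x, IsInterior D x → 6 ≤ ((skeleton D).neighborSet x).ncard) :
    6 + ∑ j ∈ range N, #(starCells r (f j)) ≤ 3 * N := by
  have hinj : Set.InjOn f (range N) := by simpa using hf.circuit.injOn
  have hsub : (range N).image f ⊆ cellVerts r := image_subset_iff.2 fun j hj =>
    mem_filter.2 ⟨mem_univ _, hf.starCells_nonempty (mem_range.1 hj)⟩
  have hsix : ∀ x ∈ cellVerts r \ (range N).image f, 6 ≤ #(starCells r x) := by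
    intro x hx
    obtain ⟨hx, hxf⟩ := mem_sdiff.1 hx
    have hx := (mem_filter.1 hx).2
    have hbd : ∀ y, bd₂ r s(x, y) = 0 := fun y => by
      rw [hf.bd₂_eq]
      refine edgeChain_apply_eq_zero fun j hj hjx => hxf (mem_image.2 ?_)
      rcases hj.lt_or_eq with hj | rfl
      · exact ⟨j, mem_range.2 hj, hjx⟩
      · have := hf.circuit.three_le
        exact ⟨0, by simp; omega, hf.circuit.closed.symm.trans hjx⟩
    rw [hD.card_starCells_eq_degree hf.chain_mem hbd hx]
    exact hdeg x (hD.isInterior_of_bd₂_eq_zero hf.chain_mem hbd hx)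
  have hinterior := card_nsmul_le_sum _ _ _ hsix
  have hsum := sum_sdiff (f := fun x => #(starCells r x)) hsub
  rw [sum_card_starCells hf.chain_mem, sum_image hinj] at hsum
  rw [card_sdiff_of_subset hsub, card_image_of_injOn hinj, card_range, smul_eq_mul] at hinterior
  have hcard := card_le_card hsub
  rw [card_image_of_injOn hinj, card_range] at hcard
  have heuler := hf.card_cellEdges_add_one_le hD
  have hedges := hf.three_mul_card_cells_add_le hD
  omega

theorem IsEnclosed.even_card_edgeCells (hf : IsEnclosed D f N r) {j : ℕ} (hj : j + 1 < N) {y : V}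
    (hy₀ : y ≠ f j) (hy₂ : y ≠ f (j + 2)) (hxy : f (j + 1) ≠ y) :
    Even #(edgeCells r s(f (j + 1), y)) := by
  rw [← ZMod.natCast_eq_zero_iff_even, ← bd₂_apply_eq_card hf.chain_mem hxy, hf.bd₂_eq]
  refine mem_supportedOn.1 (edgeChain_mem_supportedOn f N) _ ?_
  rintro ⟨i, hi, h⟩
  exact (hf.circuit.eq_or_eq_of_mk_eq hi hj h).elim hy₀ hy₂

theorem IsEnclosed.exists_mem_starCells (hf : IsEnclosed D f N r) {j : ℕ} (hj : j + 1 < N) :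
    ∃ σ ∈ starCells r (f (j + 1)), ∃ τ ∈ starCells r (f (j + 1)), f j ∈ σ ∧ f (j + 2) ∈ τ := by
  obtain ⟨σ, hσ⟩ := card_pos.1 (hf.odd_card_edgeCells (j := j) (by omega)).pos
  obtain ⟨τ, hτ⟩ := card_pos.1 (hf.odd_card_edgeCells hj).pos
  obtain ⟨hσ, ha, hx⟩ := mem_edgeCells.1 hσ
  obtain ⟨hτ, hx₁, hb⟩ := mem_edgeCells.1 hτ
  exact ⟨σ, mem_starCells.2 ⟨hσ, hx⟩, τ, mem_starCells.2 ⟨hτ, hx₁⟩, ha, hb⟩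

theorem IsEnclosed.exists_mem_cells_of_card_starCells (hf : IsEnclosed D f N r) {j : ℕ}
    (hj : j + 1 < N) (h : #(starCells r (f (j + 1))) < 2) :
    ∃ σ ∈ cells r, f j ∈ σ ∧ f (j + 1) ∈ σ ∧ f (j + 2) ∈ σ := by
  obtain ⟨σ, hσ, τ, hτ, ha, hb⟩ := hf.exists_mem_starCells hj
  obtain rfl := card_le_one.1 (Nat.le_of_lt_succ h) σ hσ τ hτ
  exact ⟨σ, (mem_starCells.1 hσ).1, ha, (mem_starCells.1 hσ).2, hb⟩

theorem IsEnclosed.two_le_card_starCells (hf : IsEnclosed D f N r) {j : ℕ} (hj : j + 1 < N)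
    (hnadj : ¬ (skeleton D).Adj (f j) (f (j + 2))) : 2 ≤ #(starCells r (f (j + 1))) := by
  by_contra! h
  obtain ⟨σ, hσ, ha, -, hb⟩ := hf.exists_mem_cells_of_card_starCells hj h
  exact hnadj (adj_of_mem_triangles (mem_triangles_of_mem_cells hf.chain_mem hσ) ha hb
    (hf.circuit.apply_ne_apply_add_two hj))

theorem IsEnclosed.exists_of_card_starCells_eq_two (hf : IsEnclosed D f N r) {j : ℕ}
    (hj : j + 1 < N) (hnadj : ¬ (skeleton D).Adj (f j) (f (j + 2)))
    (h : #(starCells r (f (j + 1))) = 2) :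
    ∃ w, {f j, f (j + 1), w} ∈ cells r ∧ {f (j + 1), w, f (j + 2)} ∈ cells r := by
  have htri {ρ : Finset V} (hρ : ρ ∈ starCells r (f (j + 1))) : ρ ∈ triangles D :=
    mem_triangles_of_mem_cells hf.chain_mem (mem_starCells.1 hρ).1
  obtain ⟨σ, hσ, τ, hτ, ha, hb⟩ := hf.exists_mem_starCells hj
  have hbσ : f (j + 2) ∉ σ := fun hbσ =>
    hnadj (adj_of_mem_triangles (htri hσ) ha hbσ (hf.circuit.apply_ne_apply_add_two hj))
  have hstar : starCells r (f (j + 1)) = {σ, τ} := (eq_of_subset_of_card_le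
    (insert_subset hσ (singleton_subset_iff.2 hτ))
    (by rw [h, card_pair (ne_of_mem_of_not_mem' hb hbσ).symm])).symm
  obtain ⟨w, rfl, haw, hxw⟩ := exists_eq_of_mem_of_mem_triangles (htri hσ) ha
    (mem_starCells.1 hσ).2 (hf.circuit.adj j (by omega)).ne
  have heven := hf.even_card_edgeCells hj haw.symm (by grind) hxw
  have hwτ : w ∈ τ := by
    by_contra hwτ
    have hone : edgeCells r s(f (j + 1), w) = {{f j, f (j + 1), w}} := by
      ext ρ
      rw [mem_edgeCells, ← and_assoc, ← mem_starCells, hstar]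
      grind
    simp [hone] at heven
  obtain ⟨b, rfl, -, -⟩ :=
    exists_eq_of_mem_of_mem_triangles (htri hτ) (mem_starCells.1 hτ).2 hwτ hxw
  have hb : f (j + 2) = b := by
    have := hf.circuit.adj (j + 1) hj
    grind
  exact ⟨w, (mem_starCells.1 hσ).1, hb ▸ (mem_starCells.1 hτ).1⟩

theorem card_cells_add_single_add_single_lt {σ τ : Finset V} (hσ : σ ∈ cells r) (hτ : τ ∈ cells r)
    (hne : σ ≠ τ) : #(cells (r + Pi.single σ 1 + Pi.single τ 1)) < #(cells r) := by
  have htwo : (1 : ZMod 2) + 1 = 0 := rfl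
  refine card_lt_card ((ssubset_iff_of_subset fun ρ hρ => ?_).2 ⟨σ, hσ, ?_⟩)
  · by_contra hρr
    have hρr : r ρ = 0 := by simpa [mem_cells] using hρr
    have hρσ : ρ ≠ σ := by
      rintro rfl
      exact mem_cells.1 hσ hρr
    have hρτ : ρ ≠ τ := by
      rintro rfl
      exact mem_cells.1 hτ hρr
    simp [mem_cells, hρr, hρσ, hρτ] at hρ
  · simp [mem_cells, hne, eq_one_of_mem_cells hσ, htwo]

theorem IsEnclosed.update (hf : IsEnclosed D f N r) {j : ℕ} (hj : j + 1 < N) {w : V}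
    (hw : ∀ i < N, f i ≠ w) (hσ : {f j, f (j + 1), w} ∈ cells r)
    (hτ : {f (j + 1), w, f (j + 2)} ∈ cells r) :
    ∃ r', IsEnclosed D (Function.update f (j + 1) w) N r' ∧ #(cells r') < #(cells r) := by
  have hσD := mem_triangles_of_mem_cells hf.chain_mem hσ
  have hτD := mem_triangles_of_mem_cells hf.chain_mem hτ
  obtain ⟨hax, haw, hxw⟩ := ne_of_mem_triangles hσD
  obtain ⟨-, hxb, hwb⟩ := ne_of_mem_triangles hτD
  have hsingle {ρ : Finset V} (hρ : ρ ∈ triangles D) :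
      (Pi.single ρ 1 : Finset V → ZMod 2) ∈ supportedOn (ZMod 2) (triangles D) :=
    mem_supportedOn.2 fun ρ' hρ' => Pi.single_eq_of_ne (ne_of_mem_of_not_mem hρ hρ').symm _
  refine ⟨r + Pi.single {f j, f (j + 1), w} 1 + Pi.single {f (j + 1), w, f (j + 2)} 1,
    ⟨hf.circuit.update hj (adj_of_mem_triangles hσD (by simp) (by simp) haw)
      (adj_of_mem_triangles hτD (by simp) (by simp) hwb) hw,
      add_mem (add_mem hf.chain_mem (hsingle hσD)) (hsingle hτD), ?_⟩,
    card_cells_add_single_add_single_lt hσ hτ ?_⟩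
  · have hupdate := edgeChain_update (f := f) hj w
    have hself (z : Sym2 V → ZMod 2) : z + z = 0 := ZModModule.add_self z
    rw [map_add, map_add, bd₂_single hax haw hxw, bd₂_single hxw hxb hwb, hf.bd₂_eq]
    linear_combination -hupdate + hself (edgeChain f N) + hself (Pi.single s(f (j + 1), w) 1)
  · have hab := hf.circuit.apply_ne_apply_add_two hj
    exact ne_of_mem_of_not_mem' (a := f j) (by simp) (by simp [hax, haw, hab])

omit [Fintype V] in
theorem IsDisc.mem_triangles_of_adj (hD : IsDisc D)
    (hdeg : ∀ x, IsInterior D x → 6 ≤ ((skeleton D).neighborSet x).ncard) {x y z : V}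
    (hxy : (skeleton D).Adj x y) (hyz : (skeleton D).Adj y z) (hxz : (skeleton D).Adj x z) :
    {x, y, z} ∈ triangles D := by
  have := hD.finite
  have := Fintype.ofFinite V
  have hcircuit : IsCircuit (skeleton D) (fun | 0 => x | 1 => y | 2 => z | _ => x) 3 := by
    refine ⟨le_rfl, fun j hj => ?_, rfl, fun i hi j hj h => ?_⟩
    · interval_cases j
      exacts [hxy, hyz, hxz.symm]
    · have := hxy.ne
      have := hyz.ne
      have := hxz.ne
      simp only [Set.mem_Iio] at hi hj
      interval_cases i <;> interval_cases j <;> grind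
  obtain ⟨r, hr⟩ := hD.exists_isEnclosed hcircuit
  have hsum := hr.six_add_sum_card_starCells_le hD hdeg
  have hx : 0 < #(starCells r x) := card_pos.2 (hr.starCells_nonempty (j := 0) (by simp))
  have hz : 0 < #(starCells r z) := card_pos.2 (hr.starCells_nonempty (j := 2) (by simp))
  have hy : #(starCells r y) < 2 := by
    simp only [sum_range_succ, sum_range_zero] at hsum
    omega
  obtain ⟨σ, hσ, hx, hy, hz⟩ := hr.exists_mem_cells_of_card_starCells (j := 0) (by simp) hy
  have hσ := mem_triangles_of_mem_cells hr.chain_mem hσ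
  obtain ⟨w, rfl, -⟩ := exists_eq_of_mem_of_mem_triangles hσ hx hy hxy.ne
  have hzw : z = w := by simpa [hxz.ne', hyz.ne'] using hz
  exact hzw ▸ hσ

end GaussBonnet

section Bigon

variable {V : Type*} {G : SimpleGraph V} {o : V}

theorem exists_geodesic (hG : G.Connected) (o x : V) : ∃ p : ℕ → V, p (G.dist o x) = x ∧
    (∀ j < G.dist o x, G.Adj (p j) (p (j + 1))) ∧ ∀ j ≤ G.dist o x, G.dist o (p j) = j := by
  obtain ⟨p, hp⟩ := hG.exists_walk_length_eq_dist o x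
  refine ⟨p.getVert, hp ▸ p.getVert_length, fun j hj => p.adj_getVert_succ (hp ▸ hj),
    fun j hj => ?_⟩
  rw [← SimpleGraph.length_eq_dist_of_subwalk hp (p.isSubwalk_take j), SimpleGraph.Walk.take_length,
    hp, min_eq_left hj]

/-- A path `τ 0, …, τ h` of length one or two between different vertices at distance `k` from `o`
whose midpoint, if any, is farther from `o`. -/
structure IsCap (G : SimpleGraph V) (o : V) (k h : ℕ) (τ : ℕ → V) : Prop where
  pos : 0 < h
  le_two : h ≤ 2
  adj : ∀ i < h, G.Adj (τ i) (τ (i + 1))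
  dist_first : G.dist o (τ 0) = k
  dist_last : G.dist o (τ h) = k
  lt_dist : ∀ i, 0 < i → i < h → k < G.dist o (τ i)
  ne : τ 0 ≠ τ h

/-- A closed walk of length `2 * L + h` which climbs a geodesic of length `L` to `τ 0`, follows
`τ 0, …, τ h`, and goes back down along another geodesic of length `L`; distances are measured
from `o`. -/
structure IsBigon (G : SimpleGraph V) (o : V) (k h : ℕ) (τ : ℕ → V) (L : ℕ) (f : ℕ → V) :
    Prop where
  adj : ∀ j < 2 * L + h, G.Adj (f j) (f (j + 1))
  closed : f (2 * L + h) = f 0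
  dist_up : ∀ j ≤ L, G.dist o (f j) + L = k + j
  top : ∀ i ≤ h, f (L + i) = τ i
  dist_down : ∀ j ≤ L, G.dist o (f (L + h + j)) + j = k

variable {k h L : ℕ} {τ f : ℕ → V}

theorem IsCap.exists_isBigon (hτ : IsCap G o k h τ) (hG : G.Connected) :
    ∃ f, IsBigon G o k h τ k f := by
  obtain ⟨p, hp, hp_adj, hp_dist⟩ := exists_geodesic hG o (τ 0)
  obtain ⟨q, hq, hq_adj, hq_dist⟩ := exists_geodesic hG o (τ h)
  rw [hτ.dist_first] at hp hp_adj hp_dist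
  rw [hτ.dist_last] at hq hq_adj hq_dist
  obtain ⟨f, hf⟩ : ∃ f : ℕ → V, f = fun j =>
    if j ≤ k then p j else if j ≤ k + h then τ (j - k) else q (2 * k + h - j) := ⟨_, rfl⟩
  have hup : ∀ j ≤ k, f j = p j := fun j hj => by rw [hf]; exact if_pos hj
  have htop : ∀ i ≤ h, f (k + i) = τ i := by grind
  have hdown : ∀ j ≤ k, f (k + h + j) = q (k - j) := by
    intro j hj
    rcases j.eq_zero_or_pos with rfl | hpos
    · rw [add_zero, htop h le_rfl, Nat.sub_zero, hq]
    · rw [hf]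
      dsimp only
      rw [if_neg (by omega), if_neg (by omega)]
      exact congrArg q (by omega)
  have hzero : p 0 = q 0 := (hG.dist_eq_zero_iff.1 (hp_dist 0 (by omega))).symm.trans
    (hG.dist_eq_zero_iff.1 (hq_dist 0 (by omega)))
  refine ⟨f, fun j hj => ?_, ?_, fun j hj => ?_, htop, fun j hj => ?_⟩
  · obtain hj | ⟨i, hi, rfl⟩ | ⟨i, hi, rfl⟩ : j < k ∨ (∃ i < h, j = k + i) ∨
        ∃ i < k, j = k + h + i := by
      by_cases hjk : j < k
      · exact .inl hjk
      by_cases hjh : j < k + h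
      · exact .inr (.inl ⟨j - k, by omega, by omega⟩)
      · exact .inr (.inr ⟨j - k - h, by omega, by omega⟩)
    · rw [hup j hj.le, hup (j + 1) hj]
      exact hp_adj j hj
    · rw [htop i hi.le, add_assoc, htop (i + 1) hi]
      exact hτ.adj i hi
    · rw [hdown i hi.le, add_assoc, hdown (i + 1) hi, ← Nat.sub_add_cancel (Nat.sub_pos_of_lt hi),
        ← Nat.sub_sub]
      exact (hq_adj _ (by omega)).symm
  · rw [show 2 * k + h = k + h + k by ring, hdown k le_rfl, hup 0 (Nat.zero_le k), hzero,
      Nat.sub_self]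
  · rw [hup j hj, hp_dist j hj, add_comm]
  · rw [hdown j hj, hq_dist _ (Nat.sub_le k j), Nat.sub_add_cancel hj]

theorem IsBigon.shift (hf : IsBigon G o k h τ L f) {i j : ℕ} (hij : i + j = L)
    (h_eq : f i = f (L + h + j)) : IsBigon G o k h τ j fun n => f (n + i) where
  adj n hn := by
    rw [add_right_comm]
    exact hf.adj _ (by omega)
  closed := by
    rw [zero_add, h_eq]
    exact congrArg f (by omega)
  dist_up n hn := by
    have := hf.dist_up (n + i) (by omega)
    omega
  top n hn := by
    rw [← hf.top n hn]
    exact congrArg f (by omega)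
  dist_down n hn := by
    rw [← hf.dist_down n (by omega)]
    exact congrArg (fun m => G.dist o (f m) + n) (by omega)

theorem IsBigon.pos (hf : IsBigon G o k h τ L f) (hτ : IsCap G o k h τ) : 0 < L := by
  rw [Nat.pos_iff_ne_zero]
  rintro rfl
  refine hτ.ne ?_
  rw [← hf.top 0 (Nat.zero_le h), ← hf.top h le_rfl, add_zero, ← hf.closed, mul_zero]

theorem IsBigon.isCircuit (hτ : IsCap G o k h τ) (hf : IsBigon G o k h τ L f)
    (hmin : ∀ j < L, ∀ g, ¬ IsBigon G o k h τ j g) : IsCircuit G f (2 * L + h) where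
  three_le := by
    have := hf.pos hτ
    have := hτ.pos
    omega
  adj := hf.adj
  closed := hf.closed
  injOn := by
    have hle := hτ.le_two
    have hclassify (j : ℕ) (hj : j < 2 * L + h) :
        j ≤ L ∧ G.dist o (f j) + L = k + j ∨
          L < j ∧ j < L + h ∧ k < G.dist o (f j) ∨
          ∃ m < L, j = L + h + m ∧ G.dist o (f j) + m = k := by
      by_cases hup : j ≤ L
      · exact .inl ⟨hup, hf.dist_up j hup⟩
      by_cases htop : j < L + h
      · refine .inr (.inl ⟨by omega, htop, ?_⟩)
        obtain ⟨i, rfl⟩ := Nat.exists_eq_add_of_le (not_le.1 hup).le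
        exact hf.top i (by omega) ▸ hτ.lt_dist i (by omega) (by omega)
      · obtain ⟨m, rfl⟩ := Nat.exists_eq_add_of_le (not_lt.1 htop)
        exact .inr (.inr ⟨m, by omega, rfl, hf.dist_down m (by omega)⟩)
    have hsides {i m : ℕ} (hi : i ≤ L) (hm : m < L) : f i ≠ f (L + h + m) := by
      intro heq
      have h₁ := hf.dist_up i hi
      have h₂ := hf.dist_down m hm.le
      rw [heq] at h₁
      exact hmin m hm _ (hf.shift (by omega) heq)
    intro i hi j hj heq
    rcases hclassify i hi with hi | hi | ⟨m, hm, rfl, hi⟩ <;>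
      rcases hclassify j hj with hj | hj | ⟨n, hn, rfl, hj⟩ <;> rw [← heq] at hj
    any_goals omega
    · exact absurd heq (hsides hi.1 hn)
    · exact absurd heq.symm (hsides hj.1 hm)

theorem IsBigon.update (hf : IsBigon G o k h τ L f) {j : ℕ} {w : V}
    (hj : j + 1 < L ∨ L + h < j + 1 ∧ j + 1 < 2 * L + h) (haw : G.Adj (f j) w)
    (hwb : G.Adj w (f (j + 2))) (hw : G.dist o w = G.dist o (f (j + 1))) :
    IsBigon G o k h τ L (Function.update f (j + 1) w) := by
  have hdist (i : ℕ) : G.dist o (Function.update f (j + 1) w i) = G.dist o (f i) := by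
    obtain rfl | hij := eq_or_ne i (j + 1)
    · rw [Function.update_self, hw]
    · rw [Function.update_of_ne hij]
  refine ⟨fun i hi => ?_, ?_, fun i hi => ?_, fun i hi => ?_, fun i hi => ?_⟩
  · have := hf.adj i hi
    grind
  · rw [Function.update_of_ne (by omega), Function.update_of_ne (by omega), hf.closed]
  · rw [hdist, hf.dist_up i hi]
  · rw [Function.update_of_ne (by omega), hf.top i hi]
  · rw [hdist, hf.dist_down i hi]

theorem IsBigon.dist_add_two_eq_or (hf : IsBigon G o k h τ L f) {j : ℕ}
    (hj : j + 1 < L ∨ L + h < j + 1 ∧ j + 1 < 2 * L + h) :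
    G.dist o (f j) + 2 = G.dist o (f (j + 2)) ∨ G.dist o (f (j + 2)) + 2 = G.dist o (f j) := by
  rcases hj with hj | hj
  · have h₀ := hf.dist_up j (by omega)
    have h₂ := hf.dist_up (j + 2) (by omega)
    omega
  · obtain ⟨m, rfl⟩ := Nat.exists_eq_add_of_le (Nat.lt_succ_iff.1 hj.1)
    have h₀ := hf.dist_down m (by omega)
    have h₂ := hf.dist_down (m + 2) (by omega)
    rw [← add_assoc (L + h)] at h₂
    omega

theorem dist_eq_dist_of_adj {a b x y : V}
    (h : G.dist o a + 2 = G.dist o b ∨ G.dist o b + 2 = G.dist o a) (hax : G.Adj a x)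
    (hxb : G.Adj x b) (hay : G.Adj a y) (hyb : G.Adj y b) : G.dist o x = G.dist o y := by
  have := hax.diff_dist_adj (u := o)
  have := hxb.diff_dist_adj (u := o)
  have := hay.diff_dist_adj (u := o)
  have := hyb.diff_dist_adj (u := o)
  omega

variable {D : AbstractSimplicialComplex V} [Fintype V] [DecidableEq V] {r : Finset V → ZMod 2}

/-- A bigon over the cap `τ` which has the shortest possible sides and, among these, encloses the
least number of 2-simplices; `r` is the region enclosed. -/
structure IsMinimalBigon (D : AbstractSimplicialComplex V) (o : V) (k h : ℕ) (τ : ℕ → V) (L : ℕ)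
    (f : ℕ → V) (r : Finset V → ZMod 2) : Prop where
  bigon : IsBigon (skeleton D) o k h τ L f
  not_lt : ∀ j < L, ∀ g, ¬ IsBigon (skeleton D) o k h τ j g
  enclosed : IsEnclosed D f (2 * L + h) r
  card_le : ∀ g q, IsBigon (skeleton D) o k h τ L g → IsEnclosed D g (2 * L + h) q →
    #(cells r) ≤ #(cells q)

theorem IsDisc.exists_isMinimalBigon (hD : IsDisc D) (hτ : IsCap (skeleton D) o k h τ) :
    ∃ L f r, IsMinimalBigon D o k h τ L f r := by
  classical
  have hex : ∃ L f, IsBigon (skeleton D) o k h τ L f := ⟨k, hτ.exists_isBigon hD.connected⟩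
  have hnot : ∀ j < Nat.find hex, ∀ g, ¬ IsBigon (skeleton D) o k h τ j g :=
    fun j hj g hg => Nat.find_min hex hj ⟨g, hg⟩
  obtain ⟨f, hf⟩ := Nat.find_spec hex
  obtain ⟨r, hr⟩ := hD.exists_isEnclosed (hf.isCircuit hτ hnot)
  have hcells : ∃ n f r, IsBigon (skeleton D) o k h τ (Nat.find hex) f ∧
      IsEnclosed D f (2 * Nat.find hex + h) r ∧ #(cells r) = n := ⟨_, f, r, hf, hr, rfl⟩
  obtain ⟨f, r, hf, hr, hcard⟩ := Nat.find_spec hcells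
  exact ⟨_, f, r, hf, hnot, hr, fun g q hg hq => hcard ▸ Nat.find_min' hcells ⟨g, q, hg, hq, rfl⟩⟩

theorem IsMinimalBigon.three_le_card_starCells (hf : IsMinimalBigon D o k h τ L f r)
    (hτ : IsCap (skeleton D) o k h τ) {j : ℕ}
    (hj : j + 1 < L ∨ L + h < j + 1 ∧ j + 1 < 2 * L + h) : 3 ≤ #(starCells r (f (j + 1))) := by
  have hjN : j + 1 < 2 * L + h := by omega
  have hdist := hf.bigon.dist_add_two_eq_or hj
  have hnadj : ¬ (skeleton D).Adj (f j) (f (j + 2)) := fun hadj => by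
    have := hadj.diff_dist_adj (u := o)
    omega
  refine (hf.enclosed.two_le_card_starCells hjN hnadj).lt_of_ne fun htwo => ?_
  obtain ⟨w, hσ, hτr⟩ := hf.enclosed.exists_of_card_starCells_eq_two hjN hnadj htwo.symm
  have hσD := mem_triangles_of_mem_cells hf.enclosed.chain_mem hσ
  have hτD := mem_triangles_of_mem_cells hf.enclosed.chain_mem hτr
  have haw := adj_of_mem_triangles hσD (x := f j) (y := w) (by simp) (by simp)
    (ne_of_mem_triangles hσD).2.1
  have hwb := adj_of_mem_triangles hτD (x := w) (y := f (j + 2)) (by simp) (by simp)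
    (ne_of_mem_triangles hτD).2.2
  have hbigon := hf.bigon.update hj haw hwb (dist_eq_dist_of_adj hdist haw hwb
    (hf.bigon.adj j (by omega)) (hf.bigon.adj (j + 1) hjN))
  have hw : ∀ i < 2 * L + h, f i ≠ w := fun i hi hiw => by
    obtain rfl | hij := eq_or_ne i (j + 1)
    · exact (ne_of_mem_triangles hσD).2.2 hiw
    · refine hij ((hbigon.isCircuit hτ hf.not_lt).injOn hi hjN ?_)
      rw [Function.update_self, Function.update_of_ne hij, hiw]
  obtain ⟨r', hr', hlt⟩ := hf.enclosed.update hjN hw hσ hτr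
  exact hlt.not_ge (hf.card_le _ r' hbigon hr')

/-- The cap cannot be shortened: nonconsecutive vertices of it are not adjacent, and no neighbour
of an end closer to `o` is adjacent to the next vertex. -/
structure IsTight (G : SimpleGraph V) (o : V) (k h : ℕ) (τ : ℕ → V) : Prop where
  not_adj : ∀ i, i + 2 ≤ h → ¬ G.Adj (τ i) (τ (i + 2))
  not_adj_first : ∀ w, G.Adj (τ 0) w → G.dist o w + 1 = k → ¬ G.Adj w (τ 1)
  not_adj_last : ∀ w, G.Adj (τ h) w → G.dist o w + 1 = k → ¬ G.Adj (τ (h - 1)) w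

theorem IsMinimalBigon.two_le_card_starCells (hf : IsMinimalBigon D o k h τ L f r)
    (hτ : IsCap (skeleton D) o k h τ) (htight : IsTight (skeleton D) o k h τ) {i : ℕ}
    (hi : i ≤ h) : 2 ≤ #(starCells r (f (L + i))) := by
  have hL := hf.bigon.pos hτ
  have hh := hτ.pos
  obtain ⟨j, hj⟩ : ∃ j, j + 1 = L + i := Nat.exists_add_one_eq.2 (by omega)
  rw [← hj]
  refine hf.enclosed.two_le_card_starCells (by omega) ?_
  have hadj := hf.bigon.adj j (by omega)
  have hadj_succ := hf.bigon.adj (j + 1) (by omega)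
  rw [hj, hf.bigon.top i hi] at hadj hadj_succ
  obtain rfl | hpos := i.eq_zero_or_pos
  · have hdist := hf.bigon.dist_up j (by omega)
    rw [show j + 2 = L + 1 by omega, hf.bigon.top 1 hh]
    exact htight.not_adj_first _ hadj.symm (by omega)
  obtain ⟨i, rfl⟩ := Nat.exists_eq_add_of_lt hpos
  rw [zero_add] at *
  rw [show j = L + i by omega, hf.bigon.top i (by omega)]
  obtain rfl | hlt := hi.eq_or_lt
  · have hdist := hf.bigon.dist_down 1 hL
    rw [show L + i + 2 = L + (i + 1) + 1 by omega]
    exact htight.not_adj_last _ (hj ▸ hadj_succ) hdist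
  · rw [add_assoc, hf.bigon.top (i + 2) hlt]
    exact htight.not_adj i hlt

omit [Fintype V] [DecidableEq V] in
theorem IsDisc.not_isTight (hD : IsDisc D)
    (hdeg : ∀ x, IsInterior D x → 6 ≤ ((skeleton D).neighborSet x).ncard)
    (hτ : IsCap (skeleton D) o k h τ) : ¬ IsTight (skeleton D) o k h τ := by
  classical
  have := hD.finite
  have := Fintype.ofFinite V
  intro htight
  obtain ⟨L, f, r, hf⟩ := hD.exists_isMinimalBigon hτ
  have := hf.bigon.pos hτ
  have hstar : ∀ j < 2 * L + h,
      3 ≤ #(starCells r (f j)) + (if j ∈ Icc L (L + h) then 1 else 0) + if j = 0 then 2 else 0 := by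
    intro j hj
    obtain rfl | hpos := j.eq_zero_or_pos
    · have : 0 < #(starCells r (f 0)) := card_pos.2 (hf.enclosed.starCells_nonempty hj)
      rw [if_pos rfl]
      omega
    rw [if_neg hpos.ne']
    split_ifs with htop
    · obtain ⟨i, rfl⟩ := Nat.exists_eq_add_of_le (mem_Icc.1 htop).1
      have := hf.two_le_card_starCells hτ htight (by simpa using htop : i ≤ h)
      omega
    · obtain ⟨i, rfl⟩ := Nat.exists_eq_add_of_lt hpos
      rw [mem_Icc] at htop
      have := hf.three_le_card_starCells hτ (j := i) (by omega)
      grind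
  have hsum := hf.enclosed.six_add_sum_card_starCells_le hD hdeg
  have hle := sum_le_sum fun j hj => hstar j (mem_range.1 hj)
  have htwo := hτ.le_two
  rw [sum_add_distrib, sum_add_distrib, sum_ite_mem, sum_ite_eq'] at hle
  have hcap : #(range (2 * L + h) ∩ Icc L (L + h)) ≤ h + 1 :=
    (card_le_card inter_subset_right).trans (by simp; omega)
  simp only [sum_const, card_range, smul_eq_mul, mul_one, mem_range] at hle
  split_ifs at hle <;> omega

omit [Fintype V] [DecidableEq V] in
theorem IsDisc.adj_of_dist_add_one_eq (hD : IsDisc D)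
    (hdeg : ∀ x, IsInterior D x → 6 ≤ ((skeleton D).neighborSet x).ncard) {x y z : V}
    (hxy : (skeleton D).Adj x y) (hxz : (skeleton D).Adj x z) (hyz : y ≠ z)
    (hy : (skeleton D).dist o y + 1 = (skeleton D).dist o x)
    (hz : (skeleton D).dist o z + 1 = (skeleton D).dist o x) : (skeleton D).Adj y z := by
  by_contra hnadj
  have hcap : IsCap (skeleton D) o ((skeleton D).dist o y) 2 (fun | 0 => y | 1 => x | _ => z) := by
    refine ⟨two_pos, le_rfl, fun i hi => ?_, rfl, by grind, fun i hi₀ hi₂ => ?_, hyz⟩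
    · interval_cases i
      exacts [hxy.symm, hxz]
    · obtain rfl : i = 1 := by omega
      exact hy ▸ Nat.lt_succ_self _
  refine hD.not_isTight hdeg hcap ⟨fun i hi => ?_, fun w _ hw hadj => ?_, fun w _ hw hadj => ?_⟩
  · obtain rfl : i = 0 := by omega
    exact hnadj
  all_goals
    have := hadj.diff_dist_adj (u := o)
    grind

omit [Fintype V] [DecidableEq V] in
theorem IsDisc.exists_adj_adj_of_dist_eq (hD : IsDisc D)
    (hdeg : ∀ x, IsInterior D x → 6 ≤ ((skeleton D).neighborSet x).ncard) {x y : V}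
    (hxy : (skeleton D).Adj x y) (hdist : (skeleton D).dist o x = (skeleton D).dist o y) :
    ∃ z, (skeleton D).Adj x z ∧ (skeleton D).Adj y z ∧
      (skeleton D).dist o z + 1 = (skeleton D).dist o x := by
  by_contra! hnone
  have hcap : IsCap (skeleton D) o ((skeleton D).dist o x) 1 (fun | 0 => x | _ => y) := by
    refine ⟨one_pos, one_le_two, fun i hi => ?_, rfl, hdist.symm, by omega, hxy.ne⟩
    obtain rfl : i = 0 := by omega
    exact hxy
  exact hD.not_isTight hdeg hcap ⟨by omega, fun w hw hdist hadj => hnone w hw hadj.symm hdist,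
    fun w hw hdist hadj => hnone w hadj hw hdist⟩

end Bigon

section Levels

variable {V : Type*}

theorem exists_adj_dist_add_one_eq {G : SimpleGraph V} (hG : G.Connected) {o x : V}
    (hx : x ≠ o) : ∃ y, G.Adj x y ∧ G.dist o y + 1 = G.dist o x := by
  obtain ⟨p, hp, hadj, hdist⟩ := exists_geodesic hG o x
  obtain ⟨n, hn⟩ := Nat.exists_add_one_eq.2 (hG.pos_dist_of_ne hx.symm)
  rw [← hn] at hp hadj hdist
  exact ⟨p n, hp ▸ (hadj n n.lt_succ_self).symm, by rw [hdist n n.le_succ, hn]⟩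

variable [Fintype V] (G : SimpleGraph V) [DecidableRel G.Adj]

/-- The neighbours of `x` which are closer to `o`. -/
def downNbrs (o x : V) : Finset V := {y ∈ G.neighborFinset x | G.dist o y + 1 = G.dist o x}

/-- The neighbours of `x` at the same distance from `o`. -/
def levelNbrs (o x : V) : Finset V := {y ∈ G.neighborFinset x | G.dist o y = G.dist o x}

/-- The neighbours of `x` which are further away from `o`. -/
def upNbrs (o x : V) : Finset V := {y ∈ G.neighborFinset x | G.dist o y = G.dist o x + 1}

variable {G} {o x y : V}

theorem mem_downNbrs : y ∈ downNbrs G o x ↔ G.Adj x y ∧ G.dist o y + 1 = G.dist o x := by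
  simp [downNbrs]

theorem mem_levelNbrs : y ∈ levelNbrs G o x ↔ G.Adj x y ∧ G.dist o y = G.dist o x := by
  simp [levelNbrs]

theorem mem_upNbrs : y ∈ upNbrs G o x ↔ G.Adj x y ∧ G.dist o y = G.dist o x + 1 := by
  simp [upNbrs]

variable [DecidableEq V]

/-- Local properties of the 1-skeleton of a triangulated disc whose interior vertices, those which
satisfy `I`, have at least six neighbours. The last two fields are the global consequences of this
degree bound: seen from any vertex `o`, the neighbours of `x` closer to `o` form a clique, and the
ends of an edge which are equally far from `o` have a common neighbour closer to `o`. -/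
structure IsDiscGraph (G : SimpleGraph V) [DecidableRel G.Adj] (I : V → Prop) : Prop where
  connected : G.Connected
  card_common_le : ∀ {x y}, G.Adj x y → #(G.neighborFinset x ∩ G.neighborFinset y) ≤ 2
  card_common : ∀ {x y}, I x → G.Adj x y → #(G.neighborFinset x ∩ G.neighborFinset y) = 2
  neighborFinset_subset : ∀ {x} {S : Finset V}, (∃ y ∈ S, G.Adj x y) →
    (∀ y ∈ S, G.Adj x y → G.neighborFinset x ∩ G.neighborFinset y ⊆ S) → G.neighborFinset x ⊆ S
  six_le_degree : ∀ {x}, I x → 6 ≤ #(G.neighborFinset x)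
  adj_of_dist : ∀ {o x y z}, G.Adj x y → G.Adj x z → y ≠ z → G.dist o y + 1 = G.dist o x →
    G.dist o z + 1 = G.dist o x → G.Adj y z
  exists_common : ∀ {o x y}, G.Adj x y → G.dist o x = G.dist o y →
    ∃ z, G.Adj x z ∧ G.Adj y z ∧ G.dist o z + 1 = G.dist o x

variable {I : V → Prop}

theorem sum_card_inter_comm (G : SimpleGraph V) [DecidableRel G.Adj] (s t : Finset V) :
    ∑ x ∈ s, #(t ∩ G.neighborFinset x) = ∑ y ∈ t, #(s ∩ G.neighborFinset y) := by
  have hinter (u : Finset V) (x : V) : u ∩ G.neighborFinset x = {y ∈ u | G.Adj x y} := by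
    ext
    simp
  simp only [hinter, card_filter]
  rw [sum_comm]
  simp only [G.adj_comm]

theorem card_eq_down_add_level_add_up {S : Finset V} (hS : S ⊆ G.neighborFinset x) (o : V) :
    #S = #(downNbrs G o x ∩ S) + #(levelNbrs G o x ∩ S) + #(upNbrs G o x ∩ S) := by
  simp only [downNbrs, levelNbrs, upNbrs, filter_inter, inter_eq_right.2 hS]
  rw [card_filter, card_filter, card_filter, card_eq_sum_ones, ← sum_add_distrib,
    ← sum_add_distrib]
  refine sum_congr rfl fun y hy => ?_
  have := ((G.mem_neighborFinset x y).1 (hS hy)).diff_dist_adj (u := o)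
  split_ifs <;> omega

theorem card_inter_eq_down_add_level_add_up (G : SimpleGraph V) [DecidableRel G.Adj] (o x y : V) :
    #(G.neighborFinset x ∩ G.neighborFinset y) = #(downNbrs G o x ∩ G.neighborFinset y) +
      #(levelNbrs G o x ∩ G.neighborFinset y) + #(upNbrs G o x ∩ G.neighborFinset y) := by
  rw [card_eq_down_add_level_add_up inter_subset_left o]
  simp only [downNbrs, levelNbrs, upNbrs, filter_inter, ← inter_assoc, inter_self]

omit [DecidableEq V] in
theorem degree_eq_down_add_level_add_up (G : SimpleGraph V) [DecidableRel G.Adj] (o x : V) :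
    #(G.neighborFinset x) = #(downNbrs G o x) + #(levelNbrs G o x) + #(upNbrs G o x) := by
  classical
  rw [card_eq_down_add_level_add_up Subset.rfl o]
  simp only [downNbrs, levelNbrs, upNbrs, filter_inter, inter_self]

theorem upNbrs_inter_eq_empty (hy : y ∈ downNbrs G o x) :
    upNbrs G o x ∩ G.neighborFinset y = ∅ := by
  refine eq_empty_of_forall_notMem fun z hz => ?_
  rw [mem_inter, mem_upNbrs, SimpleGraph.mem_neighborFinset] at hz
  rw [mem_downNbrs] at hy
  have := hz.2.diff_dist_adj (u := o)
  omega

theorem downNbrs_inter_eq_empty (hy : y ∈ upNbrs G o x) :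
    downNbrs G o x ∩ G.neighborFinset y = ∅ := by
  refine eq_empty_of_forall_notMem fun z hz => ?_
  rw [mem_inter, mem_downNbrs, SimpleGraph.mem_neighborFinset] at hz
  rw [mem_upNbrs] at hy
  have := hz.2.diff_dist_adj (u := o)
  omega

theorem sum_card_down_inter (G : SimpleGraph V) [DecidableRel G.Adj] (o : V) (S T : Finset V)
    (k : ℕ) :
    ∑ x ∈ S with G.dist o x = k + 1, #(downNbrs G o x ∩ T) =
      ∑ y ∈ T with G.dist o y = k, #(upNbrs G o y ∩ S) := by
  trans ∑ x ∈ S with G.dist o x = k + 1, #({y ∈ T | G.dist o y = k} ∩ G.neighborFinset x)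
  · refine sum_congr rfl fun x hx => congrArg card ?_
    grind [mem_downNbrs, SimpleGraph.mem_neighborFinset]
  · rw [sum_card_inter_comm]
    refine sum_congr rfl fun y hy => congrArg card ?_
    grind [mem_upNbrs, SimpleGraph.mem_neighborFinset]

theorem sum_card_level_inter (G : SimpleGraph V) [DecidableRel G.Adj] (o : V) (S T : Finset V)
    (k : ℕ) :
    ∑ x ∈ S with G.dist o x = k, #(levelNbrs G o x ∩ T) =
      ∑ y ∈ T with G.dist o y = k, #(levelNbrs G o y ∩ S) := by
  trans ∑ x ∈ S with G.dist o x = k, #({y ∈ T | G.dist o y = k} ∩ G.neighborFinset x)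
  · refine sum_congr rfl fun x hx => congrArg card ?_
    grind [mem_levelNbrs, SimpleGraph.mem_neighborFinset]
  · rw [sum_card_inter_comm]
    refine sum_congr rfl fun y hy => congrArg card ?_
    grind [mem_levelNbrs, SimpleGraph.mem_neighborFinset]

namespace IsDiscGraph

theorem downNbrs_inter_eq_erase (hG : IsDiscGraph G I) (hy : y ∈ downNbrs G o x) :
    downNbrs G o x ∩ G.neighborFinset y = (downNbrs G o x).erase y := by
  ext z
  rw [mem_inter, mem_erase, SimpleGraph.mem_neighborFinset, and_comm]
  refine and_congr_left fun hz => ⟨fun h => h.ne', fun hzy => ?_⟩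
  rw [mem_downNbrs] at hy hz
  exact hG.adj_of_dist hy.1 hz.1 hzy.symm hy.2 hz.2

theorem card_downNbrs_pos (hG : IsDiscGraph G I) (hx : x ≠ o) : 0 < #(downNbrs G o x) := by
  obtain ⟨y, hy⟩ := exists_adj_dist_add_one_eq hG.connected hx
  exact card_pos.2 ⟨y, mem_downNbrs.2 hy⟩

theorem card_downNbrs (hG : IsDiscGraph G I) (hI : I x) (hx : x ≠ o) :
    #(downNbrs G o x) = 1 ∨ #(downNbrs G o x) = 2 := by
  have hpos := hG.card_downNbrs_pos hx
  have hsub {y : V} (hy : y ∈ downNbrs G o x) :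
      (downNbrs G o x).erase y ⊆ G.neighborFinset x ∩ G.neighborFinset y :=
    hG.downNbrs_inter_eq_erase hy ▸ inter_subset_inter_right (filter_subset _ _)
  obtain ⟨y, hy⟩ := card_pos.1 hpos
  have hle := card_le_card (hsub hy)
  rw [card_erase_of_mem hy, hG.card_common hI (mem_downNbrs.1 hy).1] at hle
  by_contra hnot
  have hthree : #(downNbrs G o x) = 3 := by omega
  have hclosed : G.neighborFinset x ⊆ downNbrs G o x := by
    refine hG.neighborFinset_subset ⟨y, hy, (mem_downNbrs.1 hy).1⟩ fun z hz hxz => ?_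
    rw [← eq_of_subset_of_card_le (hsub hz)
      (by rw [hG.card_common hI hxz, card_erase_of_mem hz, hthree])]
    exact erase_subset _ _
  have := card_le_card hclosed
  have := hG.six_le_degree hI
  omega

theorem card_down_inter_level (hG : IsDiscGraph G I) (hy : y ∈ levelNbrs G o x) :
    #(downNbrs G o x ∩ G.neighborFinset y) = 1 := by
  obtain ⟨hxy, hdist⟩ := mem_levelNbrs.1 hy
  obtain ⟨z, hxz, hyz, hz⟩ := hG.exists_common hxy hdist.symm
  refine card_eq_one.2 ⟨z, eq_singleton_iff_unique_mem.2
    ⟨mem_inter.2 ⟨mem_downNbrs.2 ⟨hxz, hz⟩, by simpa⟩, fun w hw => ?_⟩⟩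
  by_contra hwz
  obtain ⟨hxw, hyw, hw⟩ : G.Adj x w ∧ G.Adj y w ∧ G.dist o w + 1 = G.dist o x := by
    simpa [mem_downNbrs, and_assoc, and_comm, and_left_comm] using hw
  have hzw := hG.adj_of_dist hxz hxw (Ne.symm hwz) hz hw
  have hcommon {a b c : V} (hza : G.Adj z a) (hzb : G.Adj z b) (hzc : G.Adj z c)
      (hab : G.Adj a b) (hac : G.Adj a c) (hbc : b ≠ c) :
      G.neighborFinset z ∩ G.neighborFinset a = {b, c} :=
    (eq_of_subset_of_card_le (by simp [insert_subset_iff, *])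
      (by rw [card_pair hbc]; exact hG.card_common_le hza)).symm
  have hsub : G.neighborFinset z ⊆ {x, y, w} := by
    refine hG.neighborFinset_subset ⟨x, by simp, hxz.symm⟩ fun a ha hza => ?_
    obtain rfl | rfl | rfl : a = x ∨ a = y ∨ a = w := by simpa using ha
    · grind [hcommon hza hyz.symm hzw hxy hxw hyw.ne]
    · grind [hcommon hza hxz.symm hzw hxy.symm hyw hxw.ne]
    · grind [hcommon hza hxz.symm hyz.symm hxw.symm hyw.symm hxy.ne]
  obtain rfl | hzo := eq_or_ne z o
  · have := hG.connected.pos_dist_of_ne (Ne.symm hwz)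
    rw [SimpleGraph.dist_self] at hz
    omega
  · obtain ⟨a, hza, ha⟩ := exists_adj_dist_add_one_eq hG.connected hzo
    obtain rfl | rfl | rfl : a = x ∨ a = y ∨ a = w := by simpa using hsub (by simpa using hza)
    all_goals omega

theorem card_level_inter_down (hG : IsDiscGraph G I) (hI : I x) (hy : y ∈ downNbrs G o x) :
    #(levelNbrs G o x ∩ G.neighborFinset y) + #(downNbrs G o x) = 3 := by
  have hcard := card_inter_eq_down_add_level_add_up G o x y
  rw [hG.card_common hI (mem_downNbrs.1 hy).1, upNbrs_inter_eq_empty hy, card_empty,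
    hG.downNbrs_inter_eq_erase hy, card_erase_of_mem hy] at hcard
  have := card_pos.2 ⟨y, hy⟩
  omega

theorem sum_down_level (hG : IsDiscGraph G I) (hI : I x) (hx : x ≠ o) :
    ∑ y ∈ downNbrs G o x, #(levelNbrs G o x ∩ G.neighborFinset y) = 2 := by
  have hcard : ∀ y ∈ downNbrs G o x,
      #(levelNbrs G o x ∩ G.neighborFinset y) = 3 - #(downNbrs G o x) := fun y hy =>
    Nat.eq_sub_of_add_eq (hG.card_level_inter_down hI hy)
  rw [sum_const_nat hcard]
  rcases hG.card_downNbrs hI hx with h | h <;> rw [h]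

theorem card_levelNbrs (hG : IsDiscGraph G I) (hI : I x) (hx : x ≠ o) :
    #(levelNbrs G o x) = 2 := by
  rw [← hG.sum_down_level hI hx, sum_card_inter_comm, card_eq_sum_ones]
  exact sum_congr rfl fun y hy => (hG.card_down_inter_level hy).symm

theorem levelNbrs_self (hG : IsDiscGraph G I) (o : V) : levelNbrs G o o = ∅ := by
  refine eq_empty_of_forall_notMem fun y hy => ?_
  rw [mem_levelNbrs, SimpleGraph.dist_self] at hy
  exact hy.1.ne (hG.connected.dist_eq_zero_iff.1 hy.2)

theorem ne_of_mem_levelNbrs (hG : IsDiscGraph G I) (hy : y ∈ levelNbrs G o x) : x ≠ o := by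
  rintro rfl
  exact notMem_empty y (hG.levelNbrs_self x ▸ hy)

/-- Two adjacent level neighbours `y`, `z` would close up the link of `x` below: it would consist
of `y`, `z` and the at most two vertices of `downNbrs G o x`. -/
theorem levelNbrs_inter_eq_empty (hG : IsDiscGraph G I) (hI : I x) (hy : y ∈ levelNbrs G o x) :
    levelNbrs G o x ∩ G.neighborFinset y = ∅ := by
  have hx := hG.ne_of_mem_levelNbrs hy
  have hlevel := hG.card_levelNbrs hI hx
  by_contra hne
  obtain ⟨z, hz, hyz⟩ : ∃ z ∈ levelNbrs G o x, G.Adj y z := by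
    simpa [Finset.Nonempty] using nonempty_of_ne_empty hne
  have hpair : {y, z} = levelNbrs G o x :=
    eq_of_subset_of_card_le (insert_subset hy (singleton_subset_iff.2 hz))
      (by rw [hlevel, card_pair hyz.ne])
  have hup : ∀ w ∈ levelNbrs G o x, #(upNbrs G o x ∩ G.neighborFinset w) = 0 := by
    intro w hw
    have hcard := card_inter_eq_down_add_level_add_up G o x w
    rw [hG.card_common hI (mem_levelNbrs.1 hw).1, hG.card_down_inter_level hw] at hcard
    have : 0 < #(levelNbrs G o x ∩ G.neighborFinset w) := by
      rw [card_pos]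
      obtain rfl | rfl : w = y ∨ w = z := by simpa [← hpair] using hw
      exacts [⟨z, mem_inter.2 ⟨hz, by simpa⟩⟩, ⟨y, mem_inter.2 ⟨hy, by simpa using hyz.symm⟩⟩]
    omega
  have hsub : G.neighborFinset x ⊆ downNbrs G o x ∪ levelNbrs G o x := by
    refine hG.neighborFinset_subset ⟨y, mem_union_right _ hy, (mem_levelNbrs.1 hy).1⟩
      fun w hw _ a ha => ?_
    have hup : upNbrs G o x ∩ G.neighborFinset w = ∅ :=
      (mem_union.1 hw).elim upNbrs_inter_eq_empty fun hw => card_eq_zero.1 (hup w hw)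
    have hadj := (G.mem_neighborFinset x a).1 (mem_inter.1 ha).1
    have := hadj.diff_dist_adj (u := o)
    have hnotUp : a ∉ upNbrs G o x := fun h =>
      notMem_empty a (hup ▸ mem_inter.2 ⟨h, (mem_inter.1 ha).2⟩)
    simp only [mem_union, mem_downNbrs, mem_levelNbrs, mem_upNbrs, hadj, true_and] at hnotUp ⊢
    omega
  have := (card_le_card hsub).trans (card_union_le _ _)
  have := hG.six_le_degree hI
  have := hG.card_downNbrs hI hx
  omega

theorem card_up_inter_level (hG : IsDiscGraph G I) (hI : I x) (hy : y ∈ levelNbrs G o x) :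
    #(upNbrs G o x ∩ G.neighborFinset y) = 1 := by
  have hcard := card_inter_eq_down_add_level_add_up G o x y
  rw [hG.card_common hI (mem_levelNbrs.1 hy).1, hG.card_down_inter_level hy,
    hG.levelNbrs_inter_eq_empty hI hy, card_empty] at hcard
  omega

theorem sum_up_level (hG : IsDiscGraph G I) (hI : I x) (hx : x ≠ o) :
    ∑ y ∈ upNbrs G o x, #(levelNbrs G o x ∩ G.neighborFinset y) = 2 := by
  rw [sum_card_inter_comm, ← hG.card_levelNbrs hI hx, card_eq_sum_ones]
  exact sum_congr rfl fun y hy => hG.card_up_inter_level hI hy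

theorem sum_up_up (hG : IsDiscGraph G I) (hI : I x) (hx : x ≠ o) :
    ∑ y ∈ upNbrs G o x, #(upNbrs G o x ∩ G.neighborFinset y) + 2 = 2 * #(upNbrs G o x) := by
  have hcard : ∀ y ∈ upNbrs G o x, #(upNbrs G o x ∩ G.neighborFinset y) +
      #(levelNbrs G o x ∩ G.neighborFinset y) = 2 := fun y hy => by
    rw [← hG.card_common hI (mem_upNbrs.1 hy).1, card_inter_eq_down_add_level_add_up G o,
      downNbrs_inter_eq_empty hy, card_empty, zero_add, add_comm]
  have hsum := sum_const_nat hcard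
  rwa [sum_add_distrib, hG.sum_up_level hI hx, mul_comm] at hsum

theorem sum_down_down (hG : IsDiscGraph G I) (hI : I x) (hx : x ≠ o) :
    ∑ y ∈ downNbrs G o x, #(downNbrs G o x ∩ G.neighborFinset y) + 2 =
      2 * #(downNbrs G o x) := by
  have hcard : ∀ y ∈ downNbrs G o x,
      #(downNbrs G o x ∩ G.neighborFinset y) = #(downNbrs G o x) - 1 := fun y hy => by
    rw [hG.downNbrs_inter_eq_erase hy, card_erase_of_mem hy]
  rw [sum_const_nat hcard]
  rcases hG.card_downNbrs hI hx with h | h <;> rw [h]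

end IsDiscGraph

end Levels

section Spheres

theorem sum_sum_card_rotate {α : Type*} {S S' : Finset α} {T T' : α → Finset α}
    {U U' : α → α → Finset α}
    (h : ∀ x y z, x ∈ S ∧ y ∈ T x ∧ z ∈ U x y ↔ y ∈ S' ∧ z ∈ T' y ∧ x ∈ U' y z) :
    ∑ x ∈ S, ∑ y ∈ T x, #(U x y) = ∑ y ∈ S', ∑ z ∈ T' y, #(U' y z) := by
  simp only [← card_sigma]
  refine card_nbij' (fun p => ⟨p.2.1, p.2.2, p.1⟩) (fun p => ⟨p.2.2, p.1, p.2.1⟩) ?_ ?_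
    (fun _ _ => rfl) fun _ _ => rfl
  · rintro ⟨x, y, z⟩ hp
    simpa [← h] using hp
  · rintro ⟨y, z, x⟩ hp
    simpa [h] using hp

variable {V : Type*}

theorem sum_card_filter_neighborFinset [Fintype V] (G : SimpleGraph V) [DecidableRel G.Adj]
    (Q : Sym2 V → Prop) [DecidablePred Q] :
    ∑ x, #{y ∈ G.neighborFinset x | Q s(x, y)} = 2 * #{e ∈ G.edgeFinset | Q e} := by
  let H : SimpleGraph V :=
    { Adj x y := G.Adj x y ∧ Q s(x, y)
      symm := ⟨fun x y h => ⟨h.1.symm, Sym2.eq_swap ▸ h.2⟩⟩ }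
  have : DecidableRel H.Adj := fun x y => inferInstanceAs (Decidable (G.Adj x y ∧ Q s(x, y)))
  have hedge : H.edgeFinset = {e ∈ G.edgeFinset | Q e} := by
    ext e
    induction e
    simp [H]
  rw [← hedge, ← H.sum_degrees_eq_twice_card_edges]
  refine sum_congr rfl fun x _ => congrArg card ?_
  ext
  simp [H]

variable [DecidableEq V] {G : SimpleGraph V} {o : V} {k : ℕ}

/-- The vertices of `A` at distance `k` from `o`. The vertex `o` itself, which lies on no edge of a
sphere, is left out. -/
def levelFinset (G : SimpleGraph V) (o : V) (A : Finset V) (k : ℕ) : Finset V :=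
  {x ∈ A | G.dist o x = k}.erase o

theorem levelFinset_add_one (G : SimpleGraph V) (o : V) (A : Finset V) (k : ℕ) :
    levelFinset G o A (k + 1) = {x ∈ A | G.dist o x = k + 1} :=
  erase_eq_of_notMem (by simp)

theorem sum_eq_two_mul_card_levelFinset {A : Finset V} {f : V → ℕ} (ho : f o = 0)
    (hf : ∀ x ∈ A, G.dist o x = k → x ≠ o → f x = 2) :
    ∑ x ∈ A with G.dist o x = k, f x = 2 * #(levelFinset G o A k) := by
  rw [← sum_erase _ ho, sum_const_nat (m := 2), levelFinset, mul_comm]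
  simp only [mem_erase, mem_filter]
  exact fun x hx => hf x hx.2.1 hx.2.2 hx.1

variable [Fintype V] [DecidableRel G.Adj] {I : V → Prop}

/-- The edges of the sphere of radius `k` about `o`. -/
def sphereFinset (G : SimpleGraph V) [DecidableRel G.Adj] (o : V) (k : ℕ) : Finset (Sym2 V) :=
  {e ∈ G.edgeFinset | ∀ x ∈ e, G.dist o x = k}

theorem sum_card_levelNbrs (G : SimpleGraph V) [DecidableRel G.Adj] (o : V) (k : ℕ) :
    ∑ x with G.dist o x = k, #(levelNbrs G o x) = 2 * #(sphereFinset G o k) := by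
  rw [sphereFinset, ← sum_card_filter_neighborFinset, sum_filter]
  refine sum_congr rfl fun x _ => ?_
  split_ifs with hx <;> simp [levelNbrs, hx]

namespace IsDiscGraph

theorem sum_card_levelNbrs_eq (hG : IsDiscGraph G I) (A : Finset V)
    (hI : ∀ x, G.dist o x = k → I x) :
    ∑ x ∈ A with G.dist o x = k, #(levelNbrs G o x) = 2 * #(levelFinset G o A k) :=
  sum_eq_two_mul_card_levelFinset (by rw [hG.levelNbrs_self, card_empty])
    fun x _ hx hne => hG.card_levelNbrs (hI x hx) hne

theorem card_sphereFinset (hG : IsDiscGraph G I) (hI : ∀ x, G.dist o x = k → I x) :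
    #(sphereFinset G o k) = #(levelFinset G o univ k) := by
  have := sum_card_levelNbrs G o k
  rw [hG.sum_card_levelNbrs_eq univ hI] at this
  omega

theorem sum_up_up_eq (hG : IsDiscGraph G I) (o : V) (k : ℕ) :
    ∑ x with G.dist o x = k, ∑ y ∈ upNbrs G o x, #(upNbrs G o x ∩ G.neighborFinset y) =
      2 * #(sphereFinset G o (k + 1)) := by
  rw [← sum_card_levelNbrs]
  trans ∑ y with G.dist o y = k + 1, ∑ z ∈ levelNbrs G o y, #(downNbrs G o y ∩ G.neighborFinset z)
  · refine sum_sum_card_rotate fun x y z => ?_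
    simp only [mem_filter_univ, mem_inter, mem_upNbrs, mem_levelNbrs, mem_downNbrs,
      SimpleGraph.mem_neighborFinset, G.adj_comm]
    grind
  · refine sum_congr rfl fun y _ => ?_
    rw [card_eq_sum_ones]
    exact sum_congr rfl fun z hz => hG.card_down_inter_level hz

theorem sum_down_down_eq (hG : IsDiscGraph G I) (hI : ∀ x, G.dist o x = k → I x) :
    ∑ x with G.dist o x = k + 1, ∑ y ∈ downNbrs G o x,
      #(downNbrs G o x ∩ G.neighborFinset y) = 2 * #(sphereFinset G o k) := by
  rw [← sum_card_levelNbrs]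
  trans ∑ y with G.dist o y = k, ∑ z ∈ levelNbrs G o y, #(upNbrs G o y ∩ G.neighborFinset z)
  · refine sum_sum_card_rotate fun x y z => ?_
    simp only [mem_filter_univ, mem_inter, mem_upNbrs, mem_levelNbrs, mem_downNbrs,
      SimpleGraph.mem_neighborFinset, G.adj_comm]
    grind
  · refine sum_congr rfl fun y hy => ?_
    rw [card_eq_sum_ones]
    exact sum_congr rfl fun z hz =>
      hG.card_up_inter_level (hI y (by simpa using hy)) hz

theorem card_sphereFinset_add (hG : IsDiscGraph G I) (hI : ∀ x, G.dist o x ≤ k + 1 → I x) :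
    #(sphereFinset G o (k + 2)) + #(sphereFinset G o k) + 4 * #{x | G.dist o x = k + 1} =
      ∑ x with G.dist o x = k + 1, #(G.neighborFinset x) := by
  have hup : _ = 2 * #(sphereFinset G o (k + 2)) := hG.sum_up_up_eq o (k + 1)
  have hdown := hG.sum_down_down_eq fun x (hx : G.dist o x = k) => hI x (by omega)
  have hsum : ∀ x ∈ ({x | G.dist o x = k + 1} : Finset V),
      ∑ y ∈ upNbrs G o x, #(upNbrs G o x ∩ G.neighborFinset y) +
        ∑ y ∈ downNbrs G o x, #(downNbrs G o x ∩ G.neighborFinset y) + 8 =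
        2 * #(G.neighborFinset x) := fun x hx => by
    rw [mem_filter_univ] at hx
    have hne : x ≠ o := by
      rintro rfl
      simp at hx
    have := hG.sum_down_down (hI x hx.le) hne
    have := hG.sum_up_up (hI x hx.le) hne
    have := hG.card_levelNbrs (hI x hx.le) hne
    have := degree_eq_down_add_level_add_up G o x
    omega
  have := sum_congr rfl hsum
  rw [sum_add_distrib, sum_add_distrib, hup, hdown, sum_const, ← mul_sum, smul_eq_mul] at this
  omega

end IsDiscGraph

end Spheres

section Discs

variable {V : Type*} [Fintype V]

theorem ncard_neighborSet (G : SimpleGraph V) [DecidableRel G.Adj] (x : V) :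
    (G.neighborSet x).ncard = #(G.neighborFinset x) := by
  rw [← Set.ncard_coe_finset, SimpleGraph.coe_neighborFinset]

variable [DecidableEq V] {D : AbstractSimplicialComplex V} [DecidableRel (skeleton D).Adj]

theorem IsDisc.coe_inter_neighborFinset (hD : IsDisc D)
    (hdeg : ∀ x, IsInterior D x → 6 ≤ ((skeleton D).neighborSet x).ncard) {x y : V}
    (hxy : (skeleton D).Adj x y) :
    ((skeleton D).neighborFinset x ∩ (skeleton D).neighborFinset y : Finset V) = apexes D x y := by
  ext z
  rw [mem_apexes_iff hxy.ne, mem_coe, mem_inter, SimpleGraph.mem_neighborFinset,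
    SimpleGraph.mem_neighborFinset]
  refine ⟨fun h => hD.mem_triangles_of_adj hdeg hxy h.2 h.1, fun h => ?_⟩
  obtain ⟨-, hxz, hyz⟩ := ne_of_mem_triangles h
  exact ⟨adj_of_mem_triangles h (by simp) (by simp) hxz,
    adj_of_mem_triangles h (by simp) (by simp) hyz⟩

theorem IsDisc.isDiscGraph (hD : IsDisc D)
    (hdeg : ∀ x, IsInterior D x → 6 ≤ ((skeleton D).neighborSet x).ncard) :
    IsDiscGraph (skeleton D) (IsInterior D) where
  connected := hD.connected
  card_common_le hxy := by
    rw [← Set.ncard_coe_finset, hD.coe_inter_neighborFinset hdeg hxy]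
    have := hD.link_degree _ _ hxy
    omega
  card_common hx hxy := by
    rw [← Set.ncard_coe_finset, hD.coe_inter_neighborFinset hdeg hxy,
      hD.ncard_apexes_of_isInterior hx hxy]
  neighborFinset_subset := by
    rintro x S ⟨y, hy, hxy⟩ hclosed z hz
    refine hD.link_induction x hxy (P := (· ∈ S)) hy (fun a b hxa ha hab => ?_)
      ((SimpleGraph.mem_neighborFinset ..).1 hz)
    rw [← mem_apexes_iff hxa.ne, ← hD.coe_inter_neighborFinset hdeg hxa] at hab
    exact hclosed a ha hxa hab
  six_le_degree hx := ncard_neighborSet (skeleton D) _ ▸ hdeg _ hx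
  adj_of_dist hxy hxz := hD.adj_of_dist_add_one_eq hdeg hxy hxz
  exists_common := hD.exists_adj_adj_of_dist_eq hdeg

end Discs

section AlternatingBalls

variable {V : Type*} [Fintype V] [DecidableEq V] {G : SimpleGraph V} [DecidableRel G.Adj]

/-- The combinatorics of an alternating pair in the ball of radius `m` about `o`: every vertex of
`B` has as many neighbours in `A` as in `B`, and the apexes of an edge spanned by vertices of `B`
are in `A`. -/
structure IsAlternatingBall (G : SimpleGraph V) [DecidableRel G.Adj] (o : V) (m t : ℕ)
    (A B : Finset V) : Prop where
  mem_or : ∀ x, G.dist o x ≤ m → x ∈ A ∨ x ∈ B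
  disjoint : Disjoint A B
  nbr_left : ∀ {x y}, x ∈ A → G.Adj x y → G.dist o y ≤ m → y ∈ B
  apex : ∀ {x y z}, x ∈ B → y ∈ B → G.Adj x y → G.Adj x z → G.Adj y z → G.dist o z ≤ m → z ∈ A
  card_right : ∀ {x}, x ∈ B → G.dist o x < m → 2 * #(G.neighborFinset x ∩ B) = t

namespace IsAlternatingBall

variable {I : V → Prop} {o : V} {k m t : ℕ} {A B : Finset V}

theorem card_levelFinset_univ (hAB : IsAlternatingBall G o m t A B) (hk : k ≤ m) :
    #(levelFinset G o univ k) = #(levelFinset G o A k) + #(levelFinset G o B k) := by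
  have hdisj : Disjoint (levelFinset G o A k) (levelFinset G o B k) :=
    hAB.disjoint.mono ((erase_subset _ _).trans (filter_subset _ _))
      ((erase_subset _ _).trans (filter_subset _ _))
  rw [← card_union_of_disjoint hdisj]
  refine congrArg card ?_
  grind [hAB.mem_or, levelFinset]

theorem sum_right_level_up (hAB : IsAlternatingBall G o m t A B) (hG : IsDiscGraph G I)
    (hk : k + 1 ≤ m) (hI : ∀ x, G.dist o x = k → I x) :
    ∑ b ∈ B with G.dist o b = k, ∑ c ∈ upNbrs G o b ∩ B, #(levelNbrs G o b ∩ G.neighborFinset c) =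
      2 * #(levelFinset G o A k) := by
  trans ∑ a ∈ A with G.dist o a = k, ∑ b ∈ levelNbrs G o a, #(upNbrs G o a ∩ G.neighborFinset b)
  · refine (sum_sum_card_rotate fun a b c => ?_).symm
    simp only [mem_filter, mem_inter, mem_upNbrs, mem_levelNbrs, SimpleGraph.mem_neighborFinset]
    refine ⟨fun ⟨⟨ha, hak⟩, ⟨hab, hb⟩, ⟨hac, hc⟩, hbc⟩ => ?_,
      fun ⟨⟨hb, hbk⟩, ⟨⟨hbc, hc⟩, hcB⟩, ⟨hba, ha⟩, hca⟩ => ?_⟩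
    · exact ⟨⟨hAB.nbr_left ha hab (by omega), by omega⟩,
        ⟨⟨hbc, by omega⟩, hAB.nbr_left ha hac (by omega)⟩, ⟨hab.symm, hb.symm⟩, hac.symm⟩
    · exact ⟨⟨hAB.apex hb hcB hbc hba hca (by omega), by omega⟩, ⟨hba.symm, by omega⟩,
        ⟨hca.symm, by omega⟩, hbc⟩
  · refine sum_eq_two_mul_card_levelFinset (by rw [hG.levelNbrs_self, sum_empty])
      fun a _ hak hao => ?_
    rw [sum_card_inter_comm, hG.sum_up_level (hI a hak) hao]

theorem sum_right_up_up (hAB : IsAlternatingBall G o m t A B) (hG : IsDiscGraph G I)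
    (hk : k + 1 ≤ m) (hI : ∀ x, G.dist o x = k + 1 → I x) :
    ∑ b ∈ B with G.dist o b = k, ∑ c ∈ upNbrs G o b ∩ B, #(upNbrs G o b ∩ G.neighborFinset c) =
      2 * #(levelFinset G o A (k + 1)) := by
  trans ∑ a ∈ A with G.dist o a = k + 1,
    ∑ b ∈ downNbrs G o a, #(levelNbrs G o a ∩ G.neighborFinset b)
  · refine (sum_sum_card_rotate fun a b c => ?_).symm
    simp only [mem_filter, mem_inter, mem_upNbrs, mem_levelNbrs, mem_downNbrs,
      SimpleGraph.mem_neighborFinset]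
    refine ⟨fun ⟨⟨ha, hak⟩, ⟨hab, hb⟩, ⟨hac, hc⟩, hbc⟩ => ?_,
      fun ⟨⟨hb, hbk⟩, ⟨⟨hbc, hc⟩, hcB⟩, ⟨hba, ha⟩, hca⟩ => ?_⟩
    · exact ⟨⟨hAB.nbr_left ha hab (by omega), by omega⟩,
        ⟨⟨hbc, by omega⟩, hAB.nbr_left ha hac (by omega)⟩, ⟨hab.symm, hb.symm⟩, hac.symm⟩
    · exact ⟨⟨hAB.apex hb hcB hbc hba hca (by omega), by omega⟩, ⟨hba.symm, by omega⟩,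
        ⟨hca.symm, by omega⟩, hbc⟩
  · refine sum_eq_two_mul_card_levelFinset ?_ fun a _ hak hao => hG.sum_down_level (hI a hak) hao
    simp [downNbrs]

/-- The two apexes of an edge of `B` between the levels `k` and `k + 1` are in `A`. Counted from
its apexes, each vertex of `A` on one of these levels sees two such edges. -/
theorem sum_up_right (hAB : IsAlternatingBall G o m t A B) (hG : IsDiscGraph G I)
    (hk : k + 1 ≤ m) (hI : ∀ x, G.dist o x ≤ k + 1 → I x) :
    ∑ b ∈ B with G.dist o b = k, #(upNbrs G o b ∩ B) =
      #(levelFinset G o A k) + #(levelFinset G o A (k + 1)) := by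
  have hcard : ∀ b ∈ ({b ∈ B | G.dist o b = k} : Finset V), ∀ c ∈ upNbrs G o b ∩ B,
      #(levelNbrs G o b ∩ G.neighborFinset c) + #(upNbrs G o b ∩ G.neighborFinset c) = 2 :=
    fun b hb c hc => by
      have hc := mem_of_mem_inter_left hc
      rw [← hG.card_common (hI b (by grind)) (mem_upNbrs.1 hc).1,
        card_inter_eq_down_add_level_add_up G o, downNbrs_inter_eq_empty hc, card_empty, zero_add]
  have hsum := sum_congr rfl fun b hb => sum_const_nat (hcard b hb)
  simp only [sum_add_distrib] at hsum
  rw [hAB.sum_right_level_up hG hk fun x hx => hI x (by omega),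
    hAB.sum_right_up_up hG hk fun x hx => hI x hx.le, ← sum_mul] at hsum
  omega

theorem sum_level_right (hAB : IsAlternatingBall G o m t A B) (hG : IsDiscGraph G I)
    (hk : k ≤ m) (hI : ∀ x, G.dist o x = k → I x) :
    ∑ b ∈ B with G.dist o b = k, #(levelNbrs G o b ∩ B) + 2 * #(levelFinset G o A k) =
      2 * #(levelFinset G o B k) := by
  rw [← hG.sum_card_levelNbrs_eq A hI, ← hG.sum_card_levelNbrs_eq B hI]
  have hleft : ∑ a ∈ A with G.dist o a = k, #(levelNbrs G o a) =
      ∑ b ∈ B with G.dist o b = k, #(levelNbrs G o b ∩ A) := by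
    rw [sum_card_level_inter]
    refine sum_congr rfl fun a ha => congrArg card (inter_eq_left.2 fun b hb => ?_).symm
    rw [mem_filter] at ha
    rw [mem_levelNbrs] at hb
    exact hAB.nbr_left ha.1 hb.1 (by omega)
  rw [hleft, ← sum_add_distrib]
  refine sum_congr rfl fun b hb => ?_
  rw [← card_union_of_disjoint
    (hAB.disjoint.symm.mono inter_subset_right inter_subset_right), ← inter_union_distrib_left]
  refine congrArg card (inter_eq_left.2 fun y hy => ?_)
  grind [mem_levelNbrs, hAB.mem_or y]

theorem card_left_add (hAB : IsAlternatingBall G o m t A B) (hG : IsDiscGraph G I)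
    (hk : k + 2 ≤ m) (hI : ∀ x, G.dist o x ≤ k + 2 → I x) :
    2 * #(levelFinset G o A (k + 2)) + 2 * #(levelFinset G o A k) +
      4 * #(levelFinset G o B (k + 1)) = t * #(levelFinset G o B (k + 1)) := by
  have hdown := sum_card_down_inter G o B B k
  rw [hAB.sum_up_right hG (by omega) fun x hx => hI x (by omega)] at hdown
  have hup : _ = _ + #(levelFinset G o A (k + 2)) := hAB.sum_up_right hG (k := k + 1) hk hI
  have hlevel := hAB.sum_level_right hG (k := k + 1) (by omega) fun x hx => hI x (by omega)
  have hcard : ∀ b ∈ ({b ∈ B | G.dist o b = k + 1} : Finset V),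
      2 * (#(downNbrs G o b ∩ B) + #(levelNbrs G o b ∩ B) + #(upNbrs G o b ∩ B)) = t :=
    fun b hb => by
      rw [mem_filter] at hb
      rw [← hAB.card_right hb.1 (by omega), card_eq_down_add_level_add_up inter_subset_left o]
      simp only [downNbrs, levelNbrs, upNbrs, filter_inter, ← inter_assoc, inter_self]
  have hsum := sum_const_nat hcard
  rw [← mul_sum, sum_add_distrib, sum_add_distrib, hdown, hup, ← levelFinset_add_one] at hsum
  rw [← levelFinset_add_one] at hlevel
  rw [mul_comm t]
  omega

end IsAlternatingBall

end AlternatingBalls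

section AlternatingPairs

theorem two_mul_card_even {t : ℕ} (ht : Even t) : 2 * #{i : Fin t | Even i.val} = t := by
  obtain ⟨m, rfl⟩ := ht
  rw [card_filter, Fin.sum_univ_eq_sum_range (fun i => if Even i then 1 else 0)]
  induction m with
  | zero => simp
  | succ m ih =>
    rw [show m + 1 + (m + 1) = m + m + 1 + 1 by ring, sum_range_succ, sum_range_succ]
    have heven : Even (m + m) := ⟨m, rfl⟩
    rw [if_pos heven, if_neg (Nat.not_even_iff_odd.2 heven.add_one)]
    omega

theorem odd_add_one_mod {i t : ℕ} (ht : Even t) (hi : Even i) : Odd ((i + 1) % t) := by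
  rw [← Nat.not_even_iff_odd, ht.mod_even_iff, Nat.not_even_iff_odd]
  exact hi.add_one

variable {V : Type*} {D : AbstractSimplicialComplex V} {s t : ℕ}

namespace IsAlternating

theorem mem_or_mem {A B : Set V} (h : IsAlternating D s t A B) {x : V} (hx : IsInterior D x) :
    x ∈ A ∨ x ∈ B :=
  h.union.ge hx

theorem six_le_degree {A B : Set V} (h : IsAlternating D s t A B) (hs : 6 ≤ s) (ht : 6 ≤ t)
    {x : V} (hx : IsInterior D x) : 6 ≤ ((skeleton D).neighborSet x).ncard := by
  rcases h.mem_or_mem hx with hx | hx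
  · rwa [(h.left hx).2]
  · rwa [(h.right hx).2]

theorem mem_left_of_adj {A B : Set V} (h : IsAlternating D s t A B) (ht : Even t) {x y z : V}
    (hx : x ∈ B) (hy : y ∈ B) (hz : IsInterior D z) (hxy : (skeleton D).Adj x y)
    (hxz : (skeleton D).Adj x z) (hyz : (skeleton D).Adj y z) : z ∈ A := by
  obtain ⟨c, -, hrange, hadj, -, hodd⟩ := h.nbrs_right x hx
  obtain ⟨i, rfl⟩ : y ∈ Set.range c := hrange.ge hxy
  obtain ⟨j, rfl⟩ : z ∈ Set.range c := hrange.ge hxz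
  have hi : Even i.val := by
    by_contra hi
    have := (hodd i (Nat.not_even_iff_odd.1 hi)).resolve_right (h.right hy).1
    exact Set.disjoint_left.1 h.disjoint this hy
  have hj : ¬ Even j.val := fun hj => by
    rcases (hadj i j).1 hyz with hij | hji
    · exact Nat.not_even_iff_odd.2 (hij ▸ odd_add_one_mod ht hi) hj
    · exact Nat.not_even_iff_odd.2 (hji ▸ odd_add_one_mod ht hj) hi
  exact (hodd j (Nat.not_even_iff_odd.1 hj)).resolve_right hz

variable [Fintype V] [DecidableEq V] [DecidableRel (skeleton D).Adj] {A B : Finset V}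

theorem two_mul_card_neighborFinset_inter (h : IsAlternating D s t (A : Set V) B) (ht : Even t)
    {x : V} (hx : x ∈ B) (hinterior : ∀ y, (skeleton D).Adj x y → IsInterior D y) :
    2 * #((skeleton D).neighborFinset x ∩ B) = t := by
  obtain ⟨c, hinj, hrange, -, heven, hodd⟩ := h.nbrs_right x hx
  have hadj (i : Fin t) : (skeleton D).Adj x (c i) := hrange.le ⟨i, rfl⟩
  refine Eq.trans ?_ (two_mul_card_even ht)
  rw [← card_image_of_injective _ hinj]
  congr 2
  ext y
  simp only [mem_inter, SimpleGraph.mem_neighborFinset, mem_image, mem_filter_univ]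
  constructor
  · rintro ⟨hxy, hy⟩
    obtain ⟨i, rfl⟩ : y ∈ Set.range c := hrange.ge hxy
    refine ⟨i, by_contra fun hi => ?_, rfl⟩
    have := (hodd i (Nat.not_even_iff_odd.1 hi)).resolve_right (hinterior _ hxy)
    exact Set.disjoint_left.1 h.disjoint this hy
  · rintro ⟨i, hi, rfl⟩
    exact ⟨hadj i, (heven i hi).resolve_right (hinterior _ (hadj i))⟩

theorem isAlternatingBall (h : IsAlternating D s t (A : Set V) B) (ht : Even t) {o : V} {m : ℕ}
    (hI : ∀ x, (skeleton D).dist o x ≤ m → IsInterior D x) :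
    IsAlternatingBall (skeleton D) o m t A B where
  mem_or x hx := h.mem_or_mem (hI x hx)
  disjoint := disjoint_coe.1 h.disjoint
  nbr_left hx hxy hy := (h.nbrs_left _ hx _ hxy).resolve_right (hI _ hy)
  apex hx hy hxy hxz hyz hz := h.mem_left_of_adj ht hx hy (hI _ hz) hxy hxz hyz
  card_right hx hxm := h.two_mul_card_neighborFinset_inter ht hx fun y hxy => by
    have := hxy.diff_dist_adj (u := o)
    exact hI y (by omega)

end IsAlternating

end AlternatingPairs

section SphereCounts

variable {V : Type*} {D : AbstractSimplicialComplex V} {o : V} {k s t : ℕ}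
  [Fintype V] [DecidableRel (skeleton D).Adj]

theorem mem_sphereVerts {A : Set V} {x : V} :
    x ∈ sphereVerts D A o k ↔ x ∈ A ∧ (skeleton D).dist o x = k ∧
      (levelNbrs (skeleton D) o x).Nonempty := by
  constructor
  · rintro ⟨hA, e, ⟨hxy, hdist⟩, y, rfl⟩
    have hx := hdist x (by simp)
    exact ⟨hA, hx, y, mem_levelNbrs.2 ⟨hxy, (hdist y (by simp)).trans hx.symm⟩⟩
  · rintro ⟨hA, hx, y, hy⟩
    obtain ⟨hxy, hdist⟩ := mem_levelNbrs.1 hy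
    exact ⟨hA, s(x, y), ⟨hxy, by simp [hx, hdist]⟩, by simp⟩

variable [DecidableEq V]

theorem ncard_sphere (D : AbstractSimplicialComplex V) [DecidableRel (skeleton D).Adj] (o : V)
    (k : ℕ) : (sphere D o k).ncard = #(sphereFinset (skeleton D) o k) := by
  rw [← Set.ncard_coe_finset]
  refine congrArg Set.ncard ?_
  ext e
  simp [sphere, sphereFinset]

variable {A B : Finset V}

theorem IsDiscGraph.ncard_sphereVerts (hG : IsDiscGraph (skeleton D) (IsInterior D))
    (A : Finset V) (hI : ∀ x, (skeleton D).dist o x = k → IsInterior D x) :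
    (sphereVerts D A o k).ncard = #(levelFinset (skeleton D) o A k) := by
  rw [← Set.ncard_coe_finset]
  refine congrArg Set.ncard ?_
  ext x
  simp only [mem_sphereVerts, levelFinset, mem_coe, mem_erase, mem_filter]
  refine ⟨fun ⟨hA, hx, y, hy⟩ => ⟨?_, hA, hx⟩, fun ⟨hne, hA, hx⟩ => ⟨hA, hx, ?_⟩⟩
  · rintro rfl
    simp [hG.levelNbrs_self] at hy
  · rw [← card_pos, hG.card_levelNbrs (hI x hx) hne]
    exact two_pos

theorem sum_card_levelNbrs_inter_self (D : AbstractSimplicialComplex V)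
    [DecidableRel (skeleton D).Adj] (B : Finset V) (o : V) (k : ℕ) :
    ∑ b ∈ B with (skeleton D).dist o b = k, #(levelNbrs (skeleton D) o b ∩ B) =
      2 * (sphereEdges D B B o k).ncard := by
  have hedges : sphereEdges D B B o k =
      ↑({e ∈ (skeleton D).edgeFinset | ∀ x ∈ e, x ∈ B ∧ (skeleton D).dist o x = k}) := by
    ext e
    rw [mem_coe, mem_filter, SimpleGraph.mem_edgeFinset]
    constructor
    · rintro ⟨⟨he, hdist⟩, x, hx, y, hy, rfl⟩
      refine ⟨he, fun z hz => ⟨?_, hdist z hz⟩⟩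
      rcases Sym2.mem_iff.1 hz with rfl | rfl <;> assumption
    · rintro ⟨he, h⟩
      induction e with
      | _ x y =>
      exact ⟨⟨he, fun z hz => (h z hz).2⟩, x, (h x (by simp)).1, y, (h y (by simp)).1, rfl⟩
  have hfilter : {b ∈ B | (skeleton D).dist o b = k} =
      ({b | b ∈ B ∧ (skeleton D).dist o b = k} : Finset V) := by
    ext
    simp
  rw [hedges, Set.ncard_coe_finset, ← sum_card_filter_neighborFinset, hfilter, sum_filter]
  refine sum_congr rfl fun b _ => ?_
  split_ifs with hb
  · refine congrArg card ?_
    ext y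
    simp [hb, mem_levelNbrs, and_assoc, and_comm]
  · simp [hb]

namespace IsAlternatingBall

variable {m : ℕ}

theorem ncard_sphere (hAB : IsAlternatingBall (skeleton D) o m t A B)
    (hG : IsDiscGraph (skeleton D) (IsInterior D)) (hk : k ≤ m)
    (hI : ∀ x, (skeleton D).dist o x = k → IsInterior D x) :
    (sphere D o k).ncard = (sphereVerts D A o k).ncard + (sphereVerts D B o k).ncard := by
  rw [STUniform.ncard_sphere, hG.card_sphereFinset hI, hAB.card_levelFinset_univ hk,
    hG.ncard_sphereVerts A hI, hG.ncard_sphereVerts B hI]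

theorem ncard_left_add (hAB : IsAlternatingBall (skeleton D) o m t A B)
    (hG : IsDiscGraph (skeleton D) (IsInterior D)) (hk : k + 2 ≤ m)
    (hI : ∀ x, (skeleton D).dist o x ≤ k + 2 → IsInterior D x) :
    2 * (sphereVerts D A o (k + 2)).ncard + 2 * (sphereVerts D A o k).ncard +
        4 * (sphereVerts D B o (k + 1)).ncard =
      t * (sphereVerts D B o (k + 1)).ncard := by
  rw [hG.ncard_sphereVerts A fun x hx => hI x (by omega),
    hG.ncard_sphereVerts A fun x hx => hI x (by omega),
    hG.ncard_sphereVerts B fun x hx => hI x (by omega), hAB.card_left_add hG hk hI]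

theorem ncard_sphereEdges_right (hAB : IsAlternatingBall (skeleton D) o m t A B)
    (hG : IsDiscGraph (skeleton D) (IsInterior D)) (hk : k ≤ m)
    (hI : ∀ x, (skeleton D).dist o x = k → IsInterior D x) :
    (sphereEdges D B B o k).ncard + (sphereVerts D A o k).ncard =
      (sphereVerts D B o k).ncard := by
  have := hAB.sum_level_right hG hk hI
  rw [sum_card_levelNbrs_inter_self] at this
  rw [hG.ncard_sphereVerts A hI, hG.ncard_sphereVerts B hI]
  omega

theorem ncard_sphereEdges_add (hAB : IsAlternatingBall (skeleton D) o m t A B) (hk : k ≤ m) :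
    (sphereEdges D A B o k).ncard + (sphereEdges D B B o k).ncard = (sphere D o k).ncard := by
  rw [← Set.ncard_union_eq]
  · refine congrArg Set.ncard (Set.Subset.antisymm ?_ fun e he => ?_)
    · rintro e (he | he) <;> exact he.1
    induction e with
    | _ x y =>
    have hx : (skeleton D).dist o x ≤ m := (he.2 x (by simp)).trans_le hk
    have hy : (skeleton D).dist o y ≤ m := (he.2 y (by simp)).trans_le hk
    rcases hAB.mem_or x hx with hxA | hxB
    · exact .inl ⟨he, x, hxA, y, hAB.nbr_left hxA he.1 hy, rfl⟩
    rcases hAB.mem_or y hy with hyA | hyB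
    · exact .inl ⟨he, y, hyA, x, hxB, Sym2.eq_swap⟩
    · exact .inr ⟨he, x, hxB, y, hyB, rfl⟩
  · rw [Set.disjoint_left]
    rintro e ⟨-, a, ha, b, -, rfl⟩ ⟨-, c, hc, d, hd, hcd⟩
    rcases Sym2.eq_iff.1 hcd with ⟨rfl, rfl⟩ | ⟨rfl, rfl⟩
    · exact disjoint_left.1 hAB.disjoint ha hc
    · exact disjoint_left.1 hAB.disjoint ha hd

end IsAlternatingBall

theorem IsAlternating.ncard_sphere_add (h : IsAlternating D s t (A : Set V) B)
    (hG : IsDiscGraph (skeleton D) (IsInterior D))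
    (hI : ∀ x, (skeleton D).dist o x ≤ k + 1 → IsInterior D x) :
    (sphere D o (k + 2)).ncard + (sphere D o k).ncard + 4 * (sphere D o (k + 1)).ncard =
      s * (sphereVerts D A o (k + 1)).ncard + t * (sphereVerts D B o (k + 1)).ncard := by
  have hI' : ∀ x, (skeleton D).dist o x = k + 1 → IsInterior D x := fun x hx => hI x hx.le
  have hunion : ({x | (skeleton D).dist o x = k + 1} : Finset V) =
      {a ∈ A | (skeleton D).dist o a = k + 1} ∪ {b ∈ B | (skeleton D).dist o b = k + 1} := by
    ext x
    simp only [mem_filter, mem_univ, true_and, mem_union, ← or_and_right]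
    exact ⟨fun hx => ⟨h.mem_or_mem (hI' x hx), hx⟩, fun hx => hx.2⟩
  have hdisj : Disjoint ({a ∈ A | (skeleton D).dist o a = k + 1} : Finset V)
      {b ∈ B | (skeleton D).dist o b = k + 1} :=
    (disjoint_coe.1 h.disjoint).mono (filter_subset _ _) (filter_subset _ _)
  have hA : ∀ a ∈ ({a ∈ A | (skeleton D).dist o a = k + 1} : Finset V),
      #((skeleton D).neighborFinset a) = s := fun a ha => by
    rw [← ncard_neighborSet, (h.left (mem_of_mem_filter a ha)).2]
  have hB : ∀ b ∈ ({b ∈ B | (skeleton D).dist o b = k + 1} : Finset V),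
      #((skeleton D).neighborFinset b) = t := fun b hb => by
    rw [← ncard_neighborSet, (h.right (mem_of_mem_filter b hb)).2]
  have hadd := hG.card_sphereFinset_add hI
  rw [hunion, sum_union hdisj, sum_const_nat hA, sum_const_nat hB, ← hunion,
    ← levelFinset_add_one, ← levelFinset_add_one, ← levelFinset_add_one,
    ← hG.card_sphereFinset hI', ← hG.ncard_sphereVerts A hI', ← hG.ncard_sphereVerts B hI',
    ← ncard_sphere, ← ncard_sphere, ← ncard_sphere] at hadd
  rw [hadd, mul_comm s, mul_comm t]

end SphereCounts

section Regular

variable {V : Type*} {D : AbstractSimplicialComplex V} {o : V} {k t : ℕ}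

theorem sphereEdges_eq_sphere {A : Set V} (hA : ∀ x, (skeleton D).dist o x = k → x ∈ A) :
    sphereEdges D A A o k = sphere D o k := by
  ext e
  refine ⟨fun h => h.1, fun h => ⟨h, ?_⟩⟩
  induction e with
  | _ x y => exact ⟨x, hA x (h.2 x (by simp)), y, hA y (h.2 y (by simp)), rfl⟩

variable [Fintype V] [DecidableEq V] [DecidableRel (skeleton D).Adj]

theorem IsDiscGraph.ncard_sphereVerts_eq_ncard_sphere
    (hG : IsDiscGraph (skeleton D) (IsInterior D)) {A : Set V}
    (hA : ∀ x, (skeleton D).dist o x = k → x ∈ A)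
    (hI : ∀ x, (skeleton D).dist o x = k → IsInterior D x) :
    (sphereVerts D A o k).ncard = (sphere D o k).ncard := by
  rw [ncard_sphere, hG.card_sphereFinset hI, ← hG.ncard_sphereVerts univ hI]
  refine congrArg Set.ncard ?_
  ext x
  simp only [mem_sphereVerts, coe_univ, Set.mem_univ, true_and]
  exact ⟨fun h => h.2, fun h => ⟨hA x h.1, h⟩⟩

theorem IsDiscGraph.ncard_sphere_add (hG : IsDiscGraph (skeleton D) (IsInterior D))
    (hreg : ∀ x, IsInterior D x → x ∈ kVertices D t)
    (hI : ∀ x, (skeleton D).dist o x ≤ k + 1 → IsInterior D x) :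
    (sphere D o (k + 2)).ncard + (sphere D o k).ncard + 4 * (sphere D o (k + 1)).ncard =
      t * (sphere D o (k + 1)).ncard := by
  have hdeg : ∀ x ∈ ({x | (skeleton D).dist o x = k + 1} : Finset V),
      #((skeleton D).neighborFinset x) = t := fun x hx => by
    rw [← ncard_neighborSet, (hreg x (hI x (mem_filter_univ x |>.1 hx).le)).2]
  have hadd := hG.card_sphereFinset_add hI
  rw [sum_const_nat hdeg, ← levelFinset_add_one, ← hG.card_sphereFinset fun x hx => hI x hx.le,
    ← ncard_sphere, ← ncard_sphere, ← ncard_sphere] at hadd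
  rw [hadd, mul_comm t]

end Regular

section Recurrences

variable {s t k n : ℕ} {v w x y z : ℕ → ℕ}

theorem RecAt.congr (hx : RecAt s t x n) (h : ∀ j ≤ n, y j = x j) : RecAt s t y n := by
  rw [RecAt] at hx ⊢
  rwa [h n le_rfl, h (n - 1) (by omega), h (n - 2) (by omega), h (n - 3) (by omega),
    h (n - 4) (by omega)]

theorem RecAt.linear_combination (hx : RecAt s t x n) (hy : RecAt s t y n) (a b : ℚ)
    (h : ∀ j ≤ n, (z j : ℚ) = a * x j + b * y j) : RecAt s t z n := by
  rw [RecAt] at hx hy ⊢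
  rw [h n le_rfl, h (n - 1) (by omega), h (n - 2) (by omega), h (n - 3) (by omega),
    h (n - 4) (by omega)]
  linear_combination a * hx + b * hy

theorem recAt_add_four (h : (x (k + 4) : ℚ) = ((t : ℚ) - 4) / 2 * x (k + 3) +
    (((s : ℚ) - 4) * ((t : ℚ) - 4) / 2 - 2) * x (k + 2) +
    ((t : ℚ) - 4) / 2 * x (k + 1) - x k) : RecAt s t x (k + 4) :=
  h

theorem recAt_of_regular
    (h : ∀ j ≤ k + 2, x (j + 2) + x j + 4 * x (j + 1) = t * x (j + 1)) :
    RecAt t t x (k + 4) := by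
  have h (j : ℕ) (hj : j ≤ k + 2) : (x (j + 2) + x j + 4 * x (j + 1) : ℚ) = t * x (j + 1) := by
    exact_mod_cast h j hj
  exact recAt_add_four (by
    linear_combination h (k + 2) le_rfl + ((t : ℚ) - 4) / 2 * h (k + 1) (by omega) +
      h k (by omega))

theorem recAt_total (hx : ∀ j ≤ k + 3, x j = v j + w j)
    (hadd : ∀ j ≤ k + 2, x (j + 2) + x j + 4 * x (j + 1) = s * v (j + 1) + t * w (j + 1))
    (hv : 2 * v (k + 3) + 2 * v (k + 1) + 4 * w (k + 2) = t * w (k + 2)) :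
    RecAt s t x (k + 4) := by
  have hx (j : ℕ) (hj : j ≤ k + 3) : (x j : ℚ) = v j + w j := by exact_mod_cast hx j hj
  have hadd (j : ℕ) (hj : j ≤ k + 2) :
      (x (j + 2) + x j : ℚ) = (s - 4) * v (j + 1) + (t - 4) * w (j + 1) := by
    have : (x (j + 2) + x j + 4 * x (j + 1) : ℚ) = s * v (j + 1) + t * w (j + 1) := by
      exact_mod_cast hadd j hj
    linear_combination this - 4 * hx (j + 1) (by omega)
  have hv : (2 * v (k + 3) + 2 * v (k + 1) + 4 * w (k + 2) : ℚ) = t * w (k + 2) := by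
    exact_mod_cast hv
  refine recAt_add_four ?_
  linear_combination hadd (k + 2) le_rfl + ((t : ℚ) - 4) / 2 * hadd (k + 1) (by omega) +
    hadd k (by omega) + ((s : ℚ) - t) / 2 * hv - (t - 4) * hx (k + 3) le_rfl -
    (t - 4) * hx (k + 1) (by omega) - (s - 4) * (t - 4) / 2 * hx (k + 2) (by omega)

theorem recAt_left_right
    (hadd : ∀ j ≤ k + 2, v (j + 2) + w (j + 2) + (v j + w j) + 4 * (v (j + 1) + w (j + 1)) =
      s * v (j + 1) + t * w (j + 1))
    (hv : ∀ j ≤ k + 2, 2 * v (j + 2) + 2 * v j + 4 * w (j + 1) = t * w (j + 1)) :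
    RecAt s t v (k + 4) ∧ RecAt s t w (k + 4) := by
  have hv (j : ℕ) (hj : j ≤ k + 2) :
      (2 * v (j + 2) + 2 * v j + 4 * w (j + 1) : ℚ) = t * w (j + 1) := by
    exact_mod_cast hv j hj
  have hw (j : ℕ) (hj : j ≤ k + 2) :
      (w (j + 2) + w j : ℚ) = (s - 4) * v (j + 1) + (t - 4) / 2 * w (j + 1) := by
    have : (v (j + 2) + w (j + 2) + (v j + w j) + 4 * (v (j + 1) + w (j + 1)) : ℚ) =
        s * v (j + 1) + t * w (j + 1) := by
      exact_mod_cast hadd j hj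
    linear_combination this - hv j hj / 2
  constructor
  · refine recAt_add_four ?_
    linear_combination hv (k + 2) le_rfl / 2 - ((t : ℚ) - 4) / 2 * (hv (k + 1) (by omega) / 2) +
      hv k (by omega) / 2 + ((t : ℚ) - 4) / 2 * hw (k + 1) (by omega)
  · refine recAt_add_four ?_
    linear_combination hw (k + 2) le_rfl + hw k (by omega) +
      ((s : ℚ) - 4) * (hv (k + 1) (by omega) / 2)

end Recurrences

section Discs

variable {V : Type*} {D : AbstractSimplicialComplex V} {A B : Set V} {o : V} {k s t : ℕ}

namespace IsDisc

theorem recAt_sphere_of_regular (hD : IsDisc D) (ht : 6 ≤ t)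
    (hreg : ∀ x, IsInterior D x → x ∈ kVertices D t)
    (hI : ∀ x, (skeleton D).dist o x < k + 4 → IsInterior D x) :
    RecAt t t (fun j => (sphere D o j).ncard) (k + 4) := by
  classical
  have := hD.finite
  have := Fintype.ofFinite V
  have hG := hD.isDiscGraph fun x hx => ht.trans_eq (hreg x hx).2.symm
  exact recAt_of_regular fun j hj => hG.ncard_sphere_add hreg fun x hx => hI x (by omega)

theorem recAt_sphereVerts_of_regular (hD : IsDisc D) (ht : 6 ≤ t)
    (hreg : ∀ x, IsInterior D x → x ∈ kVertices D t)
    (hI : ∀ x, (skeleton D).dist o x ≤ k + 4 → IsInterior D x) :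
    RecAt t t (fun j => (sphereVerts D (kVertices D t) o j).ncard) (k + 4) := by
  classical
  have := hD.finite
  have := Fintype.ofFinite V
  have hG := hD.isDiscGraph fun x hx => ht.trans_eq (hreg x hx).2.symm
  have hI' (j : ℕ) (hj : j ≤ k + 4) (x : V) (hx : (skeleton D).dist o x = j) : IsInterior D x :=
    hI x (hx.trans_le hj)
  exact (hD.recAt_sphere_of_regular ht hreg fun x hx => hI x hx.le).congr fun j hj =>
    hG.ncard_sphereVerts_eq_ncard_sphere (fun x hx => hreg x (hI' j hj x hx)) (hI' j hj)

theorem recAt_sphereEdges_of_regular (hD : IsDisc D) (ht : 6 ≤ t)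
    (hreg : ∀ x, IsInterior D x → x ∈ kVertices D t)
    (hI : ∀ x, (skeleton D).dist o x ≤ k + 4 → IsInterior D x) :
    RecAt t t (fun j => (sphereEdges D (kVertices D t) (kVertices D t) o j).ncard) (k + 4) :=
  (hD.recAt_sphere_of_regular ht hreg fun x hx => hI x hx.le).congr fun _ hj =>
    congrArg Set.ncard (sphereEdges_eq_sphere fun x hx => hreg x (hI x (hx.trans_le hj)))

theorem recAt_sphere_of_isAlternating (hD : IsDisc D) (hs : 6 ≤ s) (ht : 6 ≤ t)
    (h : IsAlternating D s t A B) (heven : Even t)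
    (hI : ∀ x, (skeleton D).dist o x < k + 4 → IsInterior D x) :
    RecAt s t (fun j => (sphere D o j).ncard) (k + 4) := by
  classical
  have := hD.finite
  have := Fintype.ofFinite V
  lift A to Finset V using Set.toFinite A
  lift B to Finset V using Set.toFinite B
  have hG := hD.isDiscGraph fun _ => h.six_le_degree hs ht
  have hAB := h.isAlternatingBall (o := o) (m := k + 3) heven fun x hx => hI x (by omega)
  exact recAt_total (fun j hj => hAB.ncard_sphere hG hj fun x hx => hI x (by omega))
    (fun j hj => h.ncard_sphere_add hG fun x hx => hI x (by omega))
    (hAB.ncard_left_add hG le_rfl fun x hx => hI x (by omega))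

theorem recAt_of_isAlternating (hD : IsDisc D) (hs : 6 ≤ s) (ht : 6 ≤ t)
    (h : IsAlternating D s t A B) (heven : Even t)
    (hI : ∀ x, (skeleton D).dist o x ≤ k + 4 → IsInterior D x) :
    RecAt s t (fun j => (sphereVerts D A o j).ncard) (k + 4) ∧
      RecAt s t (fun j => (sphereVerts D B o j).ncard) (k + 4) ∧
      RecAt s t (fun j => (sphereEdges D A B o j).ncard) (k + 4) ∧
      RecAt s t (fun j => (sphereEdges D B B o j).ncard) (k + 4) := by
  classical
  have := hD.finite
  have := Fintype.ofFinite V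
  lift A to Finset V using Set.toFinite A
  lift B to Finset V using Set.toFinite B
  have hG := hD.isDiscGraph fun _ => h.six_le_degree hs ht
  have hAB := h.isAlternatingBall heven hI
  have hsphere (j : ℕ) (hj : j ≤ k + 4) :
      (sphere D o j).ncard = (sphereVerts D A o j).ncard + (sphereVerts D B o j).ncard :=
    hAB.ncard_sphere hG hj fun x hx => hI x (by omega)
  have hBB (j : ℕ) (hj : j ≤ k + 4) :
      (sphereEdges D B B o j).ncard + (sphereVerts D A o j).ncard =
        (sphereVerts D B o j).ncard :=
    hAB.ncard_sphereEdges_right hG hj fun x hx => hI x (by omega)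
  have hedges (j : ℕ) (hj : j ≤ k + 4) :
      (sphereEdges D A B o j).ncard = 2 * (sphereVerts D A o j).ncard := by
    have := hAB.ncard_sphereEdges_add hj
    have := hBB j hj
    have := hsphere j hj
    omega
  obtain ⟨hA, hB⟩ : RecAt s t (fun j => (sphereVerts D A o j).ncard) (k + 4) ∧
      RecAt s t (fun j => (sphereVerts D B o j).ncard) (k + 4) := by
    refine recAt_left_right (fun j hj => ?_) fun j hj =>
      hAB.ncard_left_add hG (by omega) fun x hx => hI x (by omega)
    rw [← hsphere _ (by omega), ← hsphere _ (by omega), ← hsphere _ (by omega)]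
    exact h.ncard_sphere_add hG fun x hx => hI x (by omega)
  refine ⟨hA, hB, hA.linear_combination hB 2 0 fun j hj => ?_,
    hA.linear_combination hB (-1) 1 fun j hj => ?_⟩
  · simp [hedges j hj]
  · simp [← hBB j hj]

end IsDisc

end Discs

end STUniform

end

open STUniform in
theorem theorem3p1_general {V : Type*} {D : AbstractSimplicialComplex V} (hD : IsDisc D)
    {s t : ℕ} (hs : 6 ≤ s) (ht : 6 ≤ t) (hst : Even t ∨ s = t)
    (heq : s = t → ∀ x, IsInterior D x → x ∈ kVertices D t)
    (hne : s ≠ t → IsAlternating D s t (kVertices D s) (kVertices D t))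
    (o : V) {n : ℕ} (hn : 4 ≤ n) :
    ((∀ x, (skeleton D).dist o x < n → IsInterior D x) →
      RecAt s t (fun k => (sphere D o k).ncard) n) ∧
    ((∀ x, (skeleton D).dist o x ≤ n → IsInterior D x) →
      ∀ A B : Set V,
        (A = kVertices D s ∧ B = kVertices D t) ∨ (s = t ∧ Even t ∧ IsAlternating D s t A B) →
        RecAt s t (fun k => (sphereVerts D A o k).ncard) n ∧
        RecAt s t (fun k => (sphereVerts D B o k).ncard) n ∧
        RecAt s t (fun k => (sphereEdges D A B o k).ncard) n ∧
        RecAt s t (fun k => (sphereEdges D B B o k).ncard) n) := by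
  obtain ⟨k, rfl⟩ := Nat.exists_eq_add_of_le' hn
  by_cases h : s = t
  · subst h
    have hreg := heq rfl
    refine ⟨hD.recAt_sphere_of_regular hs hreg, fun hI A B hAB => ?_⟩
    rcases hAB with ⟨rfl, rfl⟩ | ⟨-, heven, hAB⟩
    · have hverts := hD.recAt_sphereVerts_of_regular hs hreg hI
      have hedges := hD.recAt_sphereEdges_of_regular hs hreg hI
      exact ⟨hverts, hverts, hedges, hedges⟩
    · exact hD.recAt_of_isAlternating hs ht hAB heven hI
  · have heven := hst.resolve_right h
    refine ⟨hD.recAt_sphere_of_isAlternating hs ht (hne h) heven, fun hI A B hAB => ?_⟩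
    obtain ⟨rfl, rfl⟩ := hAB.resolve_right fun hAB => h hAB.1
    exact hD.recAt_of_isAlternating hs ht (hne h) heven hI

theorem theorem3p1 {U : Type u} (X : AbstractSimplicialComplex U) (s t : ℕ)
    (hs : 6 ≤ s) (ht : 6 ≤ t) (hst : Even t ∨ s = t)
    (hX : STUniform.IsUniform.{u, v} X s t)
    (γ : (STUniform.skeleton X).Subgraph) (hγ : STUniform.IsLoop γ)
    {V : Type v} (D : AbstractSimplicialComplex V) (f : V → U)
    (hD : STUniform.IsMinimalFilling γ D f)
    (o : V) (ho : STUniform.IsInterior D o) (n : ℕ) (hn : 4 ≤ n) :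
    -- the lengths of spheres, as long as the vertices strictly inside the sphere are interior
    ((∀ x, (STUniform.skeleton D).dist o x < n → STUniform.IsInterior D x) →
      STUniform.RecAt s t (fun k => (STUniform.sphere D o k).ncard) n) ∧
    -- the numbers of vertices and edges of each type, for spheres in the interior;
    -- for `s ≠ t` the types are given by the numbers of neighbours, and for `s = t` (even)
    -- also by any alternating assignment of the two roles to the interior vertices
    ((∀ x, (STUniform.skeleton D).dist o x ≤ n → STUniform.IsInterior D x) →
      ∀ A B : Set V,
        (A = STUniform.kVertices D s ∧ B = STUniform.kVertices D t) ∨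
          (s = t ∧ Even t ∧ STUniform.IsAlternating D s t A B) →
        STUniform.RecAt s t (fun k => (STUniform.sphereVerts D A o k).ncard) n ∧
        STUniform.RecAt s t (fun k => (STUniform.sphereVerts D B o k).ncard) n ∧
        STUniform.RecAt s t (fun k => (STUniform.sphereEdges D A B o k).ncard) n ∧
        STUniform.RecAt s t (fun k => (STUniform.sphereEdges D B B o k).ncard) n) :=
  theorem3p1_general hD.1.disc hs ht hst (fun h => hX.of_eq h γ hγ V D f hD)
    (fun h => hX.of_ne h γ hγ V D f hD) o hn
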